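/- **Setting.** Let $\mathcal L_M$ be a finite geometric lattice with least element $\bot$ and greatest element $\hat 1$. A set $\mathcal G\subseteq \mathcal L_M\setminus\{\bot\}$ is a *building set* if for every $x\neq\bot$ with $\max\mathcal G_{\le x}=\{x_1,\dots,x_k\}$ there is a poset isomorphism $\prod_j[\bot,x_j]\to[\bot,x]$ sending $(\bot,\dots,x_j,\dots,\bot)$ to $x_j$; assume $\hat 1\in\mathcal G$. A *partial building set* is a set $\mathcal H\subseteq\mathcal G$ that contains all atoms and for which $\mathcal H^\circ:=\mathcal H\setminus\mathrm{atoms}(\mathcal L_M)$ is an upward-closed subset of $\mathcal G$. A set $S\subseteq \mathcal H$ is *$\mathcal H$-nested* if no antichain in $S$ with at least two elements has its join (in $\mathcal L_M$) in $\mathcal H$; $\mathcal N(\mathcal L_M,\mathcal H)$ is the complex of nested sets. The *combinatorial blowup* of a meet-semilattice $\mathcal L$ at $p>\bot$ is $\mathrm{Bl}_p(\mathcal L)=\{x: x\not\ge p\}\cup\{(p,x): x\not\ge p,\ p\vee x\text{ exists}\}$, where elements $x$ are ordered as in $\mathcal L$, $(p,y)\ge(p,x)$ iff $y\ge x$, $(p,y)>x$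 iff $y\ge x$, and never $x\geq (p,y)$; its blowdown map sends $x\mapsto x$ and $(p,x)\mapsto p\vee x$. Let $\mathcal L(\mathcal L_M,\mathcal H)=\mathrm{Bl}_{p_m}\circ\cdots\circ\mathrm{Bl}_{p_1}(\mathcal L_M)$, where $\mathcal H^\circ=\{p_1,\dots,p_m\}$ is listed so that larger elements come first, and let $\pi:\mathcal L(\mathcal L_M,\mathcal H)\to\mathcal L_M$ be the composite blowdown map. Writing $p$ for the atom $(p,\bot)$ when $p\in\mathcal H^\circ$, regard $\mathcal G$ as a subset of $\mathcal L(\mathcal L_M,\mathcal H)$; then $\mathcal H$ is its set of atoms. For a lattice $\mathcal L$ and $\mathcal H\subseteq\mathcal L$ put $c_g=\sum_{h\in \mathcal H,\,h\ge g}x_h$ and let $D(\mathcal L,\mathcal H)$ be the quotient of $\mathbb Q[x_h:h\in \mathcal H]$ by the ideal generated by the monomials $x_T=\prod_{h\in T}x_h$ with $T\subseteq\mathcal H$ not $\mathcal H$-nested and by $c_a$ for the atoms $a$ of $\mathcal L$. For $y\in\mathcal L(\mathcal L_M,\mathcal H)$, written $y=\bigvee S$ with $S$ an $\mathcal H$-nested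 set (regarded as a set of atoms of $\mathcal L(\mathcal L_M,\mathcal H)$), let $D_y(\mathcal L_M,\mathcal H)$ be the quotient of the same polynomial ring by the ideal generated by the $x_T$ with $S\cup T$ not $\mathcal H$-nested and by the $c_a$ for the atoms $a$ of $\mathcal L_M$. All generators $x_h$ have degree $2$. For such $y$ let $F(y)$ be the set of maximal elements of $\{g\in\mathcal G: g\le y\}$, with respect to the order of $\mathcal L(\mathcal L_M,\mathcal H)$, and let $F^+(y)=F(y)\cup\{\hat 1\}$. For $g\in F^+(y)$ put $z_y(g)=\bigvee\{f\in F^+(y): f<g\}$ (order and join in $\mathcal L_M$) and $\mathcal L_{M,y,g}=[z_y(g),g]\subseteq\mathcal L_M$. Let $\mathrm{supp}(y)=\{h\in \mathcal H: h\le y \text{ in }\mathcal L(\mathcal L_M,\mathcal H)\}$, let $V_y$ be the set of $p\in \mathcal H$ with $\mathrm{supp}(y)\cup\{p\}$ nested, and for $p\in V_y$ let $\hat p$ be the least $g\in F^+(y)$ with $p\le g$ in $\mathcal L_M$. Let $\mathcal H_{y,g}$ be the set consisting of all $p\vee z_y(g)$ with $p\in V_y$, $\hat p=g$, together with all atoms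 of $\mathcal L_{M,y,g}$, and let $\mathcal H_{y,g}^\circ$ be the set of its non-atoms in $\mathcal L_{M,y,g}$. **Theorem (Local tensor decompositions).** Let $\mathcal H\subseteq\mathcal G$ be a partial building set for a geometric lattice $\mathcal L_M$ and let $y\in\mathcal L(\mathcal L_M,\mathcal H)$ with $\pi(y)\ne\hat 1$. Then there are isomorphisms of graded $\mathbb Q$-algebras $$D_y(\mathcal L_M,\mathcal H)\;\cong\;\bigotimes_{g\in F^+(y)}D(\mathcal L_{M,y,g},\mathcal H_{y,g})\;\cong\;\bigotimes_{g\in F^+(y)\cap\mathcal H^\circ}D(\mathcal L_{M,y,g},\mathcal H_{y,g}),$$ induced (as products) by algebra homomorphisms $\psi_g:D(\mathcal L_{M,y,g},\mathcal H_{y,g})\to D_y(\mathcal L_M,\mathcal H)$ such that, for every $p\in V_y$ with $\hat p=g$ and $p\vee z_y(g)\in\mathcal H_{y,g}^\circ$, $$\psi_g(x_{p\vee z_y(g)})=x_p\ \text{ if } p\ne g,\qquad \psi_g(x_g)=c_g=\sum_{h\in\mathcal H,\;h\ge g}x_h\ \text{ if } p=g .$$ -/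

import Mathlib

open scoped TensorProduct

noncomputable section

namespace LerayModel

universe u

/-! ### Building sets -/

section Poset

variable {α : Type u} [PartialOrder α]

/-- The set of factors `max G_{≤ x}` of `x` with respect to `G`. -/
def factors (G : Set α) (x : α) : Set α :=
  {g | Maximal (fun h => h ∈ G ∧ h ≤ x) g}

open Classical in
/-- `G ⊆ α ∖ {⊥}` is a combinatorial building set: for every `x ≠ ⊥` with factors
`x₁, …, x_k` there is an isomorphism of posets `∏ⱼ [⊥, xⱼ] ≃ [⊥, x]` that sends
`(⊥, …, xⱼ, …, ⊥)` to `xⱼ` for every `j`. -/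
structure IsBuildingSet [OrderBot α] (G : Set α) : Prop where
  bot_notMem : ⊥ ∉ G
  exists_iso : ∀ x : α, x ≠ ⊥ →
    ∃ φ : ((j : factors G x) → Set.Iic (j : α)) ≃o Set.Iic x,
      ∀ j : factors G x, (φ (Function.update ⊥ j ⊤) : α) = j

/-- `H° = H ∖ atoms`. -/
def nonAtoms [OrderBot α] (H : Set α) : Set α := {p | p ∈ H ∧ ¬ IsAtom p}

/-- `H` is a partial building set in the building set `G`: it contains the atoms, and `H°`
is an order filter (upward closed subset) of `G`. -/
structure IsPartialBuildingSet [OrderBot α] (G H : Set α) : Prop where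
  subset : H ⊆ G
  atom_mem : ∀ a : α, IsAtom a → a ∈ H
  filter : ∀ p ∈ nonAtoms H, ∀ q ∈ G, p ≤ q → q ∈ nonAtoms H

/-- `S` is `H`-nested: `S ⊆ H`, and the join of an antichain in `S` with at least two elements
never lies in `H`. -/
def IsNested (H S : Set α) : Prop :=
  S ⊆ H ∧ ∀ A : Set α, A ⊆ S → A.Nontrivial → IsAntichain (· ≤ ·) A →
    ∀ j ∈ H, ¬ IsLUB A j

/-- The vertices `p` of the closed star of `S` in the complex of `H`-nested sets. -/
def closedStar (H S : Set α) : Set α := {p | p ∈ H ∧ IsNested H (S ∪ {p})}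

end Poset

/-! ### Combinatorial blowups -/

section Blowup

variable {α : Type u} [PartialOrder α]

/-- The combinatorial blowup `Bl_p(α)`. The pair `(x, false)` is the element `x` (present when
`x ≱ p`), the pair `(x, true)` is the element `(p, x)` (present when `x ≱ p` and `p ∨ x` exists).
The order is the one induced from `α × {false < true}`, so that `(p, y) ≥ (p, x)` iff `y ≥ x`,
`(p, y) > x` iff `y ≥ x`, and never `x ≥ (p, y)`. -/
def Bl (p : α) : Type u :=
  {u : α × Bool // ¬ p ≤ u.1 ∧ (u.2 = true → ∃ w, IsLUB {p, u.1} w)}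

instance (p : α) : PartialOrder (Bl p) :=
  inferInstanceAs
    (PartialOrder {u : α × Bool // ¬ p ≤ u.1 ∧ (u.2 = true → ∃ w, IsLUB {p, u.1} w)})

/-- The map `π : Bl_p(α) → α` with `π(x) = x` and `π(p, x) = p ∨ x`. -/
def Bl.down {p : α} (u : Bl p) : α :=
  if h : u.1.2 = true then (u.2.2 h).choose else u.1.1

open Classical in
/-- The element `x` of `Bl_p(α)` when `x ≱ p`. -/
def Bl.old? (p x : α) : Option (Bl p) :=
  if h : ¬ p ≤ x then some ⟨(x, false), h, fun h' => by simp at h'⟩ else none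

open Classical in
/-- The new atom `(p, ⊥)` of `Bl_p(α)`. -/
def Bl.new? (p : α) : Option (Bl p) :=
  if h : ∃ b : Bl p, b.1.2 = true ∧ IsBot b.1.1 then some h.choose else none

end Blowup

/-- A poset obtained from `L` by a sequence of blowups, with its blowdown map to `L`. For `g : L`,
`elt g` is the element of the blown-up poset that is again denoted by `g`: `g` itself if it has
survived all blowups, and the atom `(g, ⊥)` if `g` has been blown up
(and `none` if there is no such element). -/
structure Stage (L : Type u) where
  carrier : Type u
  order : PartialOrder carrier
  down : carrier → L
  elt : L → Option carrier

instance {L : Type u} (s : Stage L) : PartialOrder s.carrier := s.order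

/-- No blowup at all. -/
def Stage.init (L : Type u) [PartialOrder L] : Stage L where
  carrier := L
  order := inferInstance
  down := id
  elt := some

open Classical in
/-- The next blowup, at the element denoted by `p`. -/
def Stage.blowup {L : Type u} (s : Stage L) (p : L) : Stage L :=
  match s.elt p with
  | none => s
  | some q =>
    { carrier := Bl q
      order := inferInstance
      down := fun u => s.down u.down
      elt := fun g => if g = p then Bl.new? q else (s.elt g).bind (Bl.old? q) }

/-- `Bl_{p_m} ∘ ⋯ ∘ Bl_{p_1} (L)` for the list `l = [p_1, …, p_m]`. -/
def iteratedBlowup {L : Type u} [PartialOrder L] (l : List L) : Stage L :=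
  l.foldl Stage.blowup (Stage.init L)

/-- `s` is the partial blowup `L(L, H)`: the elements of `H°` have been blown up one after the
other, in the order of a list `p_1, …, p_m` in which larger elements come first. -/
def Stage.IsPartialBlowup {L : Type u} [PartialOrder L] [OrderBot L] (s : Stage L) (H : Set L) :
    Prop :=
  ∃ l : List L, (∀ p, p ∈ l ↔ p ∈ nonAtoms H) ∧ l.Pairwise (fun p q => ¬ p ≤ q) ∧
    s = iteratedBlowup l

/-- The support of `y`: the elements of `H`, viewed as atoms of the blowup, that lie below `y`. -/
def Stage.supp {L : Type u} (s : Stage L) (H : Set L) (y : s.carrier) : Set L :=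
  {h | h ∈ H ∧ ∃ v, s.elt h = some v ∧ v ≤ y}

/-- `F(y)`: the factors of `y` with respect to `G`, viewed as a subset of the blowup. -/
def Stage.factorsAt {L : Type u} (s : Stage L) (G : Set L) (y : s.carrier) : Set L :=
  {g | g ∈ G ∧ ∃ v, s.elt g = some v ∧
    v ∈ factors {w | ∃ g' ∈ G, s.elt g' = some w} y}

/-- `F⁺(y) = F(y) ∪ {1̂}`. -/
def Stage.factorsPlus {L : Type u} [LE L] [OrderTop L] (s : Stage L) (G : Set L)
    (y : s.carrier) : Set L :=
  s.factorsAt G y ∪ {⊤}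

/-! ### De Concini–Procesi algebras -/

section Algebra

variable {α : Type u} [PartialOrder α]

/-- `c_g = ∑_{h ∈ H, h ≥ g} x_h`. -/
def linElt (H : Set α) (g : α) : MvPolynomial H ℚ :=
  ∑ᶠ (h : H) (_ : g ≤ (h : α)), MvPolynomial.X h

/-- The ideal generated by the monomials `x_T` with `S ∪ T` not `H`-nested and by `c_a` for
the atoms `a`. -/
def localIdeal [OrderBot α] (H S : Set α) : Ideal (MvPolynomial H ℚ) :=
  Ideal.span
    ({f | ∃ T : Finset H, ¬ IsNested H (S ∪ Subtype.val '' (T : Set H)) ∧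
        f = ∏ h ∈ T, MvPolynomial.X h} ∪
      {f | ∃ a : α, IsAtom a ∧ f = linElt H a})

/-- The local De Concini–Procesi algebra `D_y(α, H)` for `y = ⋁ S`, with `S` nested. -/
abbrev LocalDP [OrderBot α] (H S : Set α) : Type u :=
  MvPolynomial H ℚ ⧸ localIdeal H S

/-- The De Concini–Procesi algebra `D(α, H)`: the monomial relations are the `x_T` with `T` not
`H`-nested. -/
abbrev DP [OrderBot α] (H : Set α) : Type u := LocalDP H ∅

/-- The class of a polynomial. -/
def LocalDP.mk [OrderBot α] (H S : Set α) (f : MvPolynomial H ℚ) : LocalDP H S :=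
  Ideal.Quotient.mk (localIdeal H S) f

/-- The part of degree `n`, every generator `x_h` having degree `2`. -/
def LocalDP.degree [OrderBot α] (H S : Set α) (n : ℕ) : Submodule ℚ (LocalDP H S) :=
  (MvPolynomial.weightedHomogeneousSubmodule ℚ (fun _ : H => 2) n).map
    (Ideal.Quotient.mkₐ ℚ (localIdeal H S)).toLinearMap

end Algebra

/-- The part of degree `n` of a finite tensor product of graded algebras: it is spanned by the
`⨂ aᵢ` with `aᵢ` of degree `dᵢ` and `∑ dᵢ = n`. -/
def tensorDegree {ι : Type*} {A : ι → Type*} [∀ i, CommRing (A i)] [∀ i, Algebra ℚ (A i)]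
    (𝒜 : ∀ i, ℕ → Submodule ℚ (A i)) (n : ℕ) : Submodule ℚ (⨂[ℚ] i, A i) :=
  Submodule.span ℚ {t | ∃ (d : ι → ℕ) (a : ∀ i, A i),
    ∑ᶠ i, d i = n ∧ (∀ i, a i ∈ 𝒜 i (d i)) ∧ t = PiTensorProduct.tprod ℚ a}

/-! ### Local intervals and local partial building sets -/

section LocalInterval

variable {L : Type u} [Lattice L] [BoundedOrder L] [Finite L]

/-- `z(g)`, the join of the `f ∈ F` with `f < g`. -/
def base (F : Set L) (g : L) : L := (Set.toFinite {f | f ∈ F ∧ f < g}).toFinset.sup id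

theorem base_le (F : Set L) (g : L) : base F g ≤ g :=
  Finset.sup_le fun f hf => by
    have h : f ∈ F ∧ f < g := by simpa using hf
    exact h.2.le

/-- The interval `[z(g), g]`. -/
abbrev LocalInterval (F : Set L) (g : L) : Type u := Set.Icc (base F g) g

instance (F : Set L) (g : L) : OrderBot (LocalInterval F g) where
  bot := ⟨base F g, le_rfl, base_le F g⟩
  bot_le q := q.2.1

/-- `p̂ = g`: the least element of `F` above `p` is `g`. -/
def IsHat (F : Set L) (p g : L) : Prop := IsLeast {f | f ∈ F ∧ p ≤ f} g

/-- The induced partial building set on `[z(g), g]`: the elements `p ∨ z(g)` for the vertices `p`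
of the closed star of `S` with `p̂ = g`, together with the atoms of `[z(g), g]`. -/
def localBuilding (H S F : Set L) (g : L) : Set (LocalInterval F g) :=
  {q | (∃ p ∈ closedStar H S, IsHat F p g ∧ (q : L) = p ⊔ base F g) ∨ IsAtom q}

/-- `H_{y,g}`. -/
abbrev Stage.localH (s : Stage L) (G H : Set L) (y : s.carrier) (g : L) :
    Set (LocalInterval (s.factorsPlus G y) g) :=
  localBuilding H (s.supp H y) (s.factorsPlus G y) g

/-- `D([z_y(g), g], H_{y,g})`. -/
abbrev Stage.LocalFactor (s : Stage L) (G H : Set L) (y : s.carrier) (g : L) : Type u :=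
  DP (s.localH G H y g)

/-- The part of degree `n` of `D([z_y(g), g], H_{y,g})`. -/
abbrev Stage.localDegree (s : Stage L) (G H : Set L) (y : s.carrier) (g : L) (n : ℕ) :
    Submodule ℚ (s.LocalFactor G H y g) :=
  LocalDP.degree (s.localH G H y g) ∅ n

end LocalInterval

end LerayModel

end

open LerayModel

noncomputable section

namespace LerayModel

universe u

set_option linter.unusedSectionVars false

section Lemmas

variable {L : Type u} [Lattice L] [BoundedOrder L] [Finite L]

/-! Write N for supp(y), V for `closedStar H N`, F for F⁺(y) and z(g) for `base F g`. Everything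
rests on one observation, `IsPartialBuildingSet.le_of_le_join`: if M is nested, an element of H°
below a join of members of M ∪ {⊤} already lies below one of those members. Consequently an element
of V and an element of F with a common nonzero lower bound are comparable (`comparable_of_star`). So
the elements of F above a given p ≠ ⊥ form a chain, and p̂ exists.

The map p ↦ p ∨ z(g) on the p in V with p̂ = g is injective on non-atoms and sends atoms to atoms of
[z(g), g]; for g in H° it reaches the whole local building set. Moreover, nestedness of N ∪ T with T
⊆ V is detected by the images of T in the intervals with g in H° (`isNested_local`,
`isNested_of_local`). Members of N ∪ {⊤} may be dropped from T (`isNested_of_diff`), which disposes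
of the generators x_g that ψ_g sends to c_g instead of x_g. This gives the monomial relations.

For the linear relations, let a be an atom with â = g in H°. An element of V above a is either ≥ g,
or is some h < g with ĥ = g. Hence c_a = c_g + ∑ x_h over the latter, which is the local relation
with c_g in the place of x_g (`sum_ge_star_eq`).

The product of the ψ_g is inverted by solving a triangular system from the top down
(`exists_values`, `exists_inverse`): x_p goes to the class of x_{p ∨ z(g)} when p ≠ g, and the image
of x_g is fixed by requiring that c_g go to x_g. If g is not in H°, the local building set consists
of atoms and the linear relations kill every generator, so such factors can be omitted.

The blowup enters only through `supp_eq`. Coordinates on the iterated blowup identify N and F in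
terms of L alone, and `StarDatum` records the outcome. -/

/-- The join of a subset of a finite bounded lattice. -/
def join (A : Set L) : L := (Set.toFinite A).toFinset.sup id

theorem isLUB_join (A : Set L) : IsLUB A (join A) := by
  have h := Finset.isLUB_sup (s := (Set.toFinite A).toFinset) (f := (id : L → L))
  simpa [join] using h

theorem le_join {A : Set L} {a : L} (h : a ∈ A) : a ≤ join A := (isLUB_join A).1 h

theorem join_le {A : Set L} {b : L} (h : ∀ a ∈ A, a ≤ b) : join A ≤ b := (isLUB_join A).2 h

theorem join_mono {A B : Set L} (h : A ⊆ B) : join A ≤ join B :=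
  join_le fun _ ha => le_join (h ha)

/-! ### Building sets -/

theorem exists_factor_ge {G : Set L} {g x : L} (hg : g ∈ G) (hx : g ≤ x) :
    ∃ k ∈ factors G x, g ≤ k := by
  obtain ⟨k, hk, hmax⟩ := (Set.toFinite {h | h ∈ G ∧ h ≤ x}).exists_le_maximal (a := g) ⟨hg, hx⟩
  exact ⟨k, hmax, hk⟩

theorem mem_of_mem_factors {G : Set L} {x k : L} (h : k ∈ factors G x) : k ∈ G := h.1.1

theorem le_of_mem_factors {G : Set L} {x k : L} (h : k ∈ factors G x) : k ≤ x := h.1.2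

theorem IsBuildingSet.ne_bot {G : Set L} (hG : IsBuildingSet G) {g : L} (hg : g ∈ G) : g ≠ ⊥ :=
  fun h => hG.bot_notMem (h ▸ hg)

-- Under the product isomorphism the two factors become vectors supported in different coordinates,
-- and these meet in ⊥.
open Classical in
theorem IsBuildingSet.inf_eq_bot_of_mem_factors {G : Set L} (hG : IsBuildingSet G) {x k k' : L}
    (hk : k ∈ factors G x) (hk' : k' ∈ factors G x) (hne : k ≠ k') : k ⊓ k' = ⊥ := by
  have hx : x ≠ ⊥ := fun h =>
    hG.ne_bot (mem_of_mem_factors hk) (le_bot_iff.1 (h ▸ le_of_mem_factors hk))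
  obtain ⟨φ, hφ⟩ := hG.exists_iso x hx
  have h1 := hφ ⟨k, hk⟩
  have h2 := hφ ⟨k', hk'⟩
  have h3 : φ (Function.update ⊥ ⟨k, hk⟩ ⊤) ⊓ φ (Function.update ⊥ ⟨k', hk'⟩ ⊤) = ⊥ := by
    rw [← map_inf, ← map_bot φ]
    congr 1
    funext j
    by_cases hj : j = ⟨k, hk⟩
    · have hj' : j ≠ ⟨k', hk'⟩ := by
        rintro rfl
        exact hne (congrArg Subtype.val hj).symm
      simp [Pi.inf_apply, Function.update_of_ne hj']
    · simp [Pi.inf_apply, Function.update_of_ne hj]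
  have h4 := congrArg Subtype.val h3
  rw [Set.Iic.coe_inf, h1, h2] at h4
  simpa using h4

theorem IsBuildingSet.factors_eq {G : Set L} (hG : IsBuildingSet G) {x k k' p : L}
    (hk : k ∈ factors G x) (hk' : k' ∈ factors G x) (hp : p ≠ ⊥) (h : p ≤ k) (h' : p ≤ k') :
    k = k' := by
  by_contra hne
  exact hp (le_bot_iff.1 ((hG.inf_eq_bot_of_mem_factors hk hk' hne) ▸ le_inf h h'))

/-- The join of two members of a building set with a common nonzero lower bound is a member. -/
theorem IsBuildingSet.sup_mem {G : Set L} (hG : IsBuildingSet G) {f f' p : L}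
    (hf : f ∈ G) (hf' : f' ∈ G) (hp : p ≠ ⊥) (h : p ≤ f) (h' : p ≤ f') : f ⊔ f' ∈ G := by
  obtain ⟨k, hk, hfk⟩ := exists_factor_ge hf (le_sup_left : f ≤ f ⊔ f')
  obtain ⟨k', hk', hfk'⟩ := exists_factor_ge hf' (le_sup_right : f' ≤ f ⊔ f')
  obtain rfl := hG.factors_eq hk hk' hp (h.trans hfk) (h'.trans hfk')
  have : k = f ⊔ f' := le_antisymm (le_of_mem_factors hk) (sup_le hfk hfk')
  exact this ▸ mem_of_mem_factors hk

open Classical in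
/-- A factor of a join of members of `G` is the join of those of them that lie below it. -/
theorem IsBuildingSet.join_factor {G : Set L} (hG : IsBuildingSet G) {A : Set L} (hA : A ⊆ G)
    {k : L} (hk : k ∈ factors G (join A)) : join {a | a ∈ A ∧ a ≤ k} = k := by
  set x := join A
  have hx0 : x ≠ ⊥ := fun h =>
    hG.ne_bot (mem_of_mem_factors hk) (le_bot_iff.1 (h ▸ le_of_mem_factors hk))
  obtain ⟨φ, hφ⟩ := hG.exists_iso x hx0
  set j : factors G x := ⟨k, hk⟩
  set u := join {a | a ∈ A ∧ a ≤ k} with hu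
  have huk : u ≤ k := join_le fun a ha => ha.2
  have hux : u ≤ x := huk.trans (le_of_mem_factors hk)
  -- `W` is ⊤ except in the coordinate of `k`, where it is that of `u`. It bounds every member of
  -- `A`, since members not below `k` vanish in that coordinate. As `A` has join `x`, this forces `W
  -- = ⊤`, and hence `u = k`.
  set W : (i : factors G x) → Set.Iic (i : L) :=
    Function.update ⊤ j (φ.symm ⟨u, hux⟩ j) with hW
  have hAW : ∀ a ∈ A, a ≤ (φ W : L) := by
    intro a ha
    have hax : a ≤ x := le_join ha
    suffices h : (⟨a, hax⟩ : Set.Iic x) ≤ φ W from h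
    rw [← φ.symm_apply_le]
    intro i
    by_cases hi : i = j
    · subst hi
      rw [hW, Function.update_self]
      by_cases hak : a ≤ k
      · exact φ.symm.monotone (show (⟨a, hax⟩ : Set.Iic x) ≤ ⟨u, hux⟩ from le_join ⟨ha, hak⟩) _
      · obtain ⟨k', hk', hak'⟩ := exists_factor_ge (hA ha) hax
        have hne : (⟨k', hk'⟩ : factors G x) ≠ j := by
          intro h
          have hkk : k' = k := congrArg Subtype.val h
          exact hak (hkk ▸ hak')
        have h1 : (⟨a, hax⟩ : Set.Iic x) ≤ φ (Function.update ⊥ ⟨k', hk'⟩ ⊤) :=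
          show a ≤ (φ (Function.update ⊥ ⟨k', hk'⟩ ⊤) : L) from (hφ ⟨k', hk'⟩).symm ▸ hak'
        rw [← φ.symm_apply_le] at h1
        have h2 := h1 j
        rw [Function.update_of_ne hne.symm] at h2
        exact h2.trans bot_le
    · rw [hW, Function.update_of_ne hi]
      exact le_top
  have hWtop : W = ⊤ := by
    have : φ W = ⊤ := top_le_iff.1 (show x ≤ (φ W : L) from join_le hAW)
    exact φ.injective (by rw [this, map_top])
  have h3 : φ.symm ⟨u, hux⟩ j = ⊤ := by
    have := congrFun hWtop j
    rwa [hW, Function.update_self] at this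
  have h4 : φ (Function.update ⊥ j ⊤) ≤ ⟨u, hux⟩ := by
    rw [← φ.le_symm_apply]
    intro i
    by_cases hi : i = j
    · subst hi; rw [Function.update_self, h3]
    · rw [Function.update_of_ne hi]; exact bot_le
  have h5 : (φ (Function.update ⊥ j ⊤) : L) ≤ u := h4
  rw [hφ j] at h5
  exact le_antisymm huk h5

theorem IsBuildingSet.exists_join_eq {G : Set L} (hG : IsBuildingSet G) {A : Set L} (hA : A ⊆ G)
    {h : L} (hh : h ∈ G) (hle : h ≤ join A) : ∃ k ∈ G, h ≤ k ∧ join {a | a ∈ A ∧ a ≤ k} = k := by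
  obtain ⟨k, hk, hhk⟩ := exists_factor_ge hh hle
  exact ⟨k, mem_of_mem_factors hk, hhk, hG.join_factor hA hk⟩

/-! ### Nested sets -/

/-- The maximal elements of a set with join `k` form an antichain with the same join. It is not
empty because `k` is not least, and not a singleton because its members are strictly below `k`. With
the converse below, nestedness can be tested without mentioning antichains. -/
theorem IsNested.not_isLUB_lt {α : Type u} [PartialOrder α] [Finite α] {H M : Set α}
    (hM : IsNested H M) {k : α} (hk : k ∈ H) (hbot : ¬ IsBot k) :
    ¬ IsLUB {s | s ∈ M ∧ s < k} k := by
  intro hl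
  set B := {s | s ∈ M ∧ s < k} with hB
  set A := {s | Maximal (· ∈ B) s} with hA
  have hle : ∀ s ∈ B, ∃ a ∈ A, s ≤ a := fun s hs => by
    obtain ⟨a, h1, h2⟩ := (Set.toFinite B).exists_le_maximal hs
    exact ⟨a, h2, h1⟩
  have hAl : IsLUB A k := by
    refine ⟨fun a ha => hl.1 ha.1, fun b hb => hl.2 fun s hs => ?_⟩
    obtain ⟨a, ha, hsa⟩ := hle s hs
    exact hsa.trans (hb ha)
  by_cases hnt : A.Nontrivial
  · refine hM.2 A (fun a ha => ha.1.1) hnt ?_ k hk hAl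
    intro a ha b hb hne hab
    exact hne (le_antisymm hab (ha.2 hb.1 hab))
  · rw [Set.not_nontrivial_iff] at hnt
    rcases hnt.eq_empty_or_singleton with h | ⟨m, hm⟩
    · rw [h] at hAl
      exact hbot fun b => hAl.2 (by simp [upperBounds])
    · have h1 : m ∈ A := by simp [hm]
      have h2 : k ≤ m := hAl.2 (by simp [hm, upperBounds])
      exact absurd h1.1.2 (not_lt_of_ge h2)

/-- An antichain with at least two elements cannot contain its own join, so all its members are
strictly below it. -/
theorem isNested_of_not_isLUB_lt {α : Type u} [PartialOrder α] {H M : Set α} (hsub : M ⊆ H)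
    (h : ∀ k ∈ H, ¬ IsLUB {s | s ∈ M ∧ s < k} k) : IsNested H M := by
  refine ⟨hsub, fun A hA hnt hanti j hj hl => h j hj ?_⟩
  refine ⟨fun s hs => hs.2.le, fun b hb => hl.2 fun a ha => hb ⟨hA ha, ?_⟩⟩
  refine lt_of_le_of_ne (hl.1 ha) ?_
  rintro rfl
  obtain ⟨c, hc, hne⟩ := hnt.exists_ne a
  exact hanti hc ha hne (hl.1 hc)

theorem IsNested.join_lt_ne {H M : Set L} (hM : IsNested H M) {k : L} (hk : k ∈ H) (h0 : k ≠ ⊥) :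
    join {s | s ∈ M ∧ s < k} ≠ k := fun h =>
  hM.not_isLUB_lt hk (fun hb => h0 (le_bot_iff.1 (hb ⊥))) (by
    have := isLUB_join {s | s ∈ M ∧ s < k}
    rwa [h] at this)

theorem IsNested.mono {α : Type u} [PartialOrder α] {H M M' : Set α} (hM : IsNested H M)
    (h : M' ⊆ M) : IsNested H M' :=
  ⟨h.trans hM.1, fun A hA => hM.2 A (hA.trans h)⟩

/-- Nestedness only has to be tested on the non-atoms of `H`. -/
theorem isNested_of_join_lt_ne {H M : Set L} (hb : ⊥ ∉ H) (hsub : M ⊆ H)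
    (h : ∀ k ∈ nonAtoms H, join {s | s ∈ M ∧ s < k} ≠ k) : IsNested H M := by
  refine isNested_of_not_isLUB_lt hsub fun k hk hl => ?_
  have hj : join {s | s ∈ M ∧ s < k} = k := (isLUB_join _).unique hl
  refine h k ⟨hk, fun hat => ?_⟩ hj
  have : join {s | s ∈ M ∧ s < k} ≤ ⊥ := join_le fun s hs => by
    exact absurd (hat.lt_iff.1 hs.2 ▸ hsub hs.1) hb
  rw [hj] at this
  exact hat.1 (le_bot_iff.1 this)

end Lemmas

/-! ### The closed star of a nested set and the tree-like structure of F⁺(y). -/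

section Star

variable {L : Type u} [Lattice L] [BoundedOrder L] [Finite L]

/-- The factor `k` of `join A` above `h` lies in H° by the filter property and is the join of the
members of `A` below it. If `k` were not in `A`, it would be a join of members of `M` strictly below
it, against nestedness. -/
theorem IsPartialBuildingSet.le_of_le_join {G H : Set L} (hG : IsBuildingSet G)
    (hH : IsPartialBuildingSet G H) {M A : Set L} (hM : IsNested H M) (hA : A ⊆ insert ⊤ M)
    {h : L} (hh : h ∈ nonAtoms H) (hle : h ≤ join A) : ∃ a ∈ A, h ≤ a := by
  by_cases htop : ⊤ ∈ A
  · exact ⟨⊤, htop, le_top⟩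
  have hAM : A ⊆ M := fun a ha => (hA ha).resolve_left (fun e => htop (e ▸ ha))
  obtain ⟨k, hk, hhk, hjk⟩ := hG.exists_join_eq (hAM.trans (hM.1.trans hH.subset))
    (hH.subset hh.1) hle
  by_cases hkA : k ∈ A
  · exact ⟨k, hkA, hhk⟩
  exfalso
  have hkn := hH.filter h hh k hk hhk
  refine hM.join_lt_ne hkn.1 (hG.ne_bot hk) (le_antisymm (join_le fun s hs => hs.2.le) ?_)
  rw [← hjk]
  refine (join_mono fun a ha => ?_)
  rw [hjk]
  exact ⟨hAM ha.1, lt_of_le_of_ne ha.2 (fun e => hkA (e ▸ ha.1))⟩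

/-- A nested set `N` (the support of an element `y` of the blowup), the corresponding set
`F = F⁺(y)`, and the join `x` of the atoms in `N`. -/
structure StarDatum (G H N F : Set L) (x : L) : Prop where
  building : IsBuildingSet G
  top_mem : ⊤ ∈ G
  partialBuilding : IsPartialBuildingSet G H
  nested : IsNested H N
  atom_mem_iff : ∀ a, IsAtom a → (a ∈ N ↔ a ≤ x)
  mem_F_iff : ∀ f, f ∈ F ↔ f = ⊤ ∨ (f ∈ N ∧ f ∈ nonAtoms H) ∨ f ∈ factors G x

variable [IsAtomistic L]

theorem eq_join_atoms (b : L) : b = join {a | IsAtom a ∧ a ≤ b} :=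
  (isLUB_atoms_le b).unique (isLUB_join _)

namespace StarDatum

variable {G H N F : Set L} {x : L} (D : StarDatum G H N F x)
include D

theorem mem_G {h : L} (hh : h ∈ H) : h ∈ G := D.partialBuilding.subset hh

theorem ne_bot {h : L} (hh : h ∈ G) : h ≠ ⊥ := D.building.ne_bot hh

theorem bot_notMem : ⊥ ∉ H := fun h => D.ne_bot (D.mem_G h) rfl

theorem filter {h g : L} (hh : h ∈ nonAtoms H) (hg : g ∈ G) (hle : h ≤ g) : g ∈ nonAtoms H :=
  D.partialBuilding.filter h hh g hg hle

theorem atom_of_notMem {h : L} (hh : h ∈ H) (hn : h ∉ nonAtoms H) : IsAtom h := by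
  by_contra hc
  exact hn ⟨hh, hc⟩

theorem top_mem_F : ⊤ ∈ F := (D.mem_F_iff ⊤).2 (Or.inl rfl)

theorem F_mem_G {f : L} (hf : f ∈ F) : f ∈ G := by
  rcases (D.mem_F_iff f).1 hf with rfl | h | h
  · exact D.top_mem
  · exact D.mem_G h.2.1
  · exact mem_of_mem_factors h

theorem le_of_le_join {M A : Set L} (hM : IsNested H M) (hA : A ⊆ insert ⊤ M)
    {h : L} (hh : h ∈ nonAtoms H) (hle : h ≤ join A) : ∃ a ∈ A, h ≤ a :=
  D.partialBuilding.le_of_le_join D.building hM hA hh hle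

/-- `x` is a join of atoms belonging to `N`, so an element of H° below `x` would lie below a single
atom. -/
theorem not_le_x {h : L} (hh : h ∈ nonAtoms H) : ¬ h ≤ x := by
  intro hle
  rw [eq_join_atoms x] at hle
  obtain ⟨a, ha, hha⟩ := D.le_of_le_join D.nested
    (fun a ha => Or.inr ((D.atom_mem_iff a ha.1).2 ha.2)) hh hle
  rcases ha.1.le_iff.1 hha with h0 | h0
  · exact D.ne_bot (D.mem_G hh.1) h0
  · exact hh.2 (h0 ▸ ha.1)

theorem mem_insert_of_mem_F {f : L} (hf : f ∈ F) (hn : f ∈ nonAtoms H) : f ∈ insert ⊤ N := by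
  rcases (D.mem_F_iff f).1 hf with rfl | h | h
  · exact Or.inl rfl
  · exact Or.inr h.1
  · exact absurd (le_of_mem_factors h) (D.not_le_x hn)

theorem mem_factors_of_mem_F {f : L} (hf : f ∈ F) (hn : f ∉ nonAtoms H) (ht : f ≠ ⊤) :
    f ∈ factors G x := by
  rcases (D.mem_F_iff f).1 hf with h | h | h
  · exact absurd h ht
  · exact absurd h.2 hn
  · exact h

/-- Members of `F` need not lie in `H`. This replaces them by members of `N`, to which
`le_of_le_join` applies. -/
theorem le_join_of_mem_F {f : L} (hf : f ∈ F) (ht : f ≠ ⊤) : f ≤ join {n | n ∈ N ∧ n ≤ f} := by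
  rcases (D.mem_F_iff f).1 hf with h | h | h
  · exact absurd h ht
  · exact le_join ⟨h.1, le_rfl⟩
  · conv_lhs => rw [eq_join_atoms f]
    exact join_mono fun a ha =>
      ⟨(D.atom_mem_iff a ha.1).2 (ha.2.trans (le_of_mem_factors h)), ha.2⟩

/-- The common lower bound puts `h ⊔ g` in `G`. If it is in H°, it lies below `h` or below some `n ≤
g` in `N`, since `N ∪ {h}` is nested. Otherwise `h` is an atom and equals `p`. -/
theorem comparable_of_star {h g p : L} (hh : h ∈ closedStar H N) (hg : g ∈ F) (hp : p ≠ ⊥)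
    (hph : p ≤ h) (hpg : p ≤ g) : h ≤ g ∨ g ≤ h := by
  by_cases ht : g = ⊤
  · exact Or.inl (ht ▸ le_top)
  have hk := D.building.sup_mem (D.mem_G hh.1) (D.F_mem_G hg) hp hph hpg
  by_cases hn : h ⊔ g ∈ nonAtoms H
  · have hle : h ⊔ g ≤ join ({h} ∪ {n | n ∈ N ∧ n ≤ g}) :=
      sup_le (le_join (Or.inl rfl))
        ((D.le_join_of_mem_F hg ht).trans (join_mono fun n hn => Or.inr hn))
    obtain ⟨a, ha, hka⟩ := D.le_of_le_join hh.2 (A := {h} ∪ {n | n ∈ N ∧ n ≤ g}) (by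
      rintro a (rfl | ha)
      · exact Or.inr (Or.inr rfl)
      · exact Or.inr (Or.inl ha.1)) hn hle
    rcases ha with rfl | ha
    · exact Or.inr (le_sup_right.trans hka)
    · exact Or.inl (le_sup_left.trans (hka.trans ha.2))
  · have hat := D.atom_of_notMem hh.1 (fun h' => hn (D.filter h' hk le_sup_left))
    rcases hat.le_iff.1 hph with h0 | h0
    · exact absurd h0 hp
    · exact Or.inl (h0 ▸ hpg)

theorem mem_star_of_mem {n : L} (hn : n ∈ N) : n ∈ closedStar H N :=
  ⟨D.nested.1 hn, by rw [Set.union_singleton, Set.insert_eq_of_mem hn]; exact D.nested⟩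

theorem mem_star_of_mem_F {g : L} (hg : g ∈ F) (hn : g ∈ nonAtoms H) : g ∈ closedStar H N := by
  rcases D.mem_insert_of_mem_F hg hn with rfl | h
  · refine ⟨hn.1, isNested_of_join_lt_ne D.bot_notMem ?_ fun k hk hj => ?_⟩
    · exact Set.union_subset D.nested.1 (Set.singleton_subset_iff.2 hn.1)
    · obtain ⟨a, ha, hka⟩ := D.le_of_le_join (A := {s | s ∈ N ∪ {⊤} ∧ s < k}) D.nested (by
        rintro a ⟨ha | ha, -⟩
        · exact Or.inr ha
        · exact Or.inl ha) hk hj.ge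
      exact absurd ha.2 (not_lt_of_ge hka)
  · exact D.mem_star_of_mem h

theorem comparable {f g p : L} (hf : f ∈ F) (hg : g ∈ F) (hp : p ≠ ⊥)
    (hpf : p ≤ f) (hpg : p ≤ g) : f ≤ g ∨ g ≤ f := by
  by_cases h1 : f ∈ nonAtoms H
  · exact D.comparable_of_star (D.mem_star_of_mem_F hf h1) hg hp hpf hpg
  by_cases h2 : g ∈ nonAtoms H
  · exact (D.comparable_of_star (D.mem_star_of_mem_F hg h2) hf hp hpg hpf).symm
  by_cases h3 : f = ⊤
  · exact Or.inr (h3 ▸ le_top)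
  by_cases h4 : g = ⊤
  · exact Or.inl (h4 ▸ le_top)
  exact Or.inl (D.building.factors_eq (D.mem_factors_of_mem_F hf h1 h3)
    (D.mem_factors_of_mem_F hg h2 h4) hp hpf hpg).le

theorem exists_isHat {p : L} (hp : p ≠ ⊥) : ∃ g, IsHat F p g := by
  obtain ⟨g, -, hg⟩ := (Set.toFinite {f | f ∈ F ∧ p ≤ f}).exists_le_minimal
    (a := ⊤) ⟨D.top_mem_F, le_top⟩
  refine ⟨g, hg.1, fun f hf => ?_⟩
  rcases D.comparable hf.1 hg.1.1 hp hf.2 hg.1.2 with h | h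
  · exact hg.2 hf h
  · exact h

theorem le_base {f g : L} (hf : f ∈ F) (hfg : f < g) : f ≤ base F g := le_join ⟨hf, hfg⟩

/-- The join defining z(g) behaves like a disjoint one: a member of `G` below it sits under a single
`f`. -/
theorem exists_of_le_base {a g : L} (ha : a ∈ G) (hle : a ≤ base F g) :
    ∃ f ∈ F, f < g ∧ a ≤ f := by
  obtain ⟨k, hk, hak, hjk⟩ := D.building.exists_join_eq (A := {f | f ∈ F ∧ f < g})
    (fun f hf => D.F_mem_G hf.1) ha hle
  by_cases hn : k ∈ nonAtoms H
  · have hB : k ≤ join {n | n ∈ N ∧ ∃ f ∈ F, f < g ∧ n ≤ f} := by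
      rw [← hjk]
      refine join_le fun f hf => (D.le_join_of_mem_F hf.1.1 (hf.1.2.trans_le le_top).ne).trans ?_
      exact join_mono fun _ hn => ⟨hn.1, f, hf.1.1, hf.1.2, hn.2⟩
    obtain ⟨n, ⟨-, f, hf, hfg, hnf⟩, hkn⟩ := D.le_of_le_join D.nested
      (fun n hn => Or.inr hn.1) hn hB
    exact ⟨f, hf, hfg, hak.trans (hkn.trans hnf)⟩
  -- Outside H°, all the `f ≤ k` are factors of `x`, so `k ≤ x`. The factor of `x` above `k` then
  -- contains such an `f`, and must coincide with it.
  · have hfac : ∀ f, f ∈ F → f < g → f ≤ k → f ∈ factors G x := fun f hf hfg hfk =>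
      D.mem_factors_of_mem_F hf (fun h => hn (D.filter h hk hfk)) (hfg.trans_le le_top).ne
    have hkx : k ≤ x := by
      rw [← hjk]
      exact join_le fun f hf => le_of_mem_factors (hfac f hf.1.1 hf.1.2 hf.2)
    obtain ⟨k', hk', hkk'⟩ := exists_factor_ge hk hkx
    have hne : ∃ f, f ∈ F ∧ f < g ∧ f ≤ k := by
      by_contra hc
      refine D.ne_bot hk (le_bot_iff.1 ?_)
      rw [← hjk]
      exact join_le fun f hf => absurd ⟨f, hf.1.1, hf.1.2, hf.2⟩ hc
    obtain ⟨f, hf, hfg, hfk⟩ := hne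
    have := D.building.factors_eq (hfac f hf hfg hfk) hk' (D.ne_bot (D.F_mem_G hf)) le_rfl
      (hfk.trans hkk')
    exact ⟨f, hf, hfg, hak.trans (hkk'.trans this.ge)⟩

theorem not_le_base_of_isHat {a g : L} (ha : a ∈ G) (hat : IsHat F a g) : ¬ a ≤ base F g := by
  intro h
  obtain ⟨f, hf, hfg, haf⟩ := D.exists_of_le_base ha h
  exact absurd hfg (not_lt_of_ge (hat.2 ⟨hf, haf⟩))

theorem isHat_of_not_le_base {a g : L} (ha : a ≠ ⊥) (hg : g ∈ F) (hag : a ≤ g)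
    (hb : ¬ a ≤ base F g) : IsHat F a g := by
  refine ⟨⟨hg, hag⟩, fun f hf => ?_⟩
  rcases D.comparable hf.1 hg ha hf.2 hag with h | h
  · rcases h.eq_or_lt with h | h
    · exact h.ge
    · exact absurd (hf.2.trans (D.le_base hf.1 h)) hb
  · exact h

theorem isHat_self {g : L} (hg : g ∈ F) : IsHat F g g := ⟨⟨hg, le_rfl⟩, fun _ hf => hf.2⟩

theorem base_le_join {g : L} : base F g ≤ join {n | n ∈ N ∧ n ≤ base F g} :=
  join_le fun _ hf => (D.le_join_of_mem_F hf.1 (hf.2.trans_le le_top).ne).trans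
    (join_mono fun _ hn => ⟨hn.1, hn.2.trans (D.le_base hf.1 hf.2)⟩)

/-- z(g) is absorbed into the join as the join of the members of `N` below it. -/
theorem le_of_le_join_sup_base {M A : Set L} (hM : IsNested H M) (hNM : N ⊆ M)
    (hA : A ⊆ insert ⊤ M) {h g : L} (hh : h ∈ nonAtoms H) (hle : h ≤ join A ⊔ base F g) :
    (∃ a ∈ A, h ≤ a) ∨ h ≤ base F g := by
  have hle' : h ≤ join (A ∪ {n | n ∈ N ∧ n ≤ base F g}) :=
    hle.trans (sup_le (join_mono Set.subset_union_left)
      (D.base_le_join.trans (join_mono Set.subset_union_right)))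
  obtain ⟨a, ha | ha, hha⟩ := D.le_of_le_join hM
    (Set.union_subset hA (fun n hn => Or.inr (hNM hn.1))) hh hle'
  · exact Or.inl ⟨a, ha, hha⟩
  · exact Or.inr (hha.trans ha.2)

theorem le_of_le_sup_base {p h g : L} (hp : p ∈ closedStar H N) (hh : h ∈ nonAtoms H)
    (hle : h ≤ p ⊔ base F g) : h ≤ p ∨ h ≤ base F g := by
  have := D.le_of_le_join_sup_base (A := {p}) hp.2 Set.subset_union_left
    (fun a ha => Or.inr (Or.inr ha)) hh (hle.trans (sup_le_sup_right (le_join (Set.mem_singleton p)) _))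
  simpa using this

theorem le_base_of_mem {a g : L} (ha : a ∈ N) (hg : g ∈ F) (hgn : g ∈ nonAtoms H)
    (hlt : a < g) : a ≤ base F g := by
  by_cases hn : a ∈ nonAtoms H
  · exact D.le_base ((D.mem_F_iff a).2 (Or.inr (Or.inl ⟨ha, hn⟩))) hlt
  · have hat := D.atom_of_notMem (D.nested.1 ha) hn
    obtain ⟨k, hk, hak⟩ := exists_factor_ge (D.mem_G (D.nested.1 ha)) ((D.atom_mem_iff a hat).1 ha)
    have hkF : k ∈ F := (D.mem_F_iff k).2 (Or.inr (Or.inr hk))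
    have hgk : ¬ g ≤ k := fun h => D.not_le_x hgn (h.trans (le_of_mem_factors hk))
    rcases D.comparable hkF hg hat.1 hak hlt.le with h | h
    · exact hak.trans (D.le_base hkF (lt_of_le_not_ge h hgk))
    · exact absurd h hgk

theorem lt_of_join_eq {p j : L} (hj : j ∈ nonAtoms H)
    (h : join {s | s ∈ N ∪ {p} ∧ s < j} = j) :
    p < j ∧ j ≤ join {n | n ∈ N ∧ n < j} ⊔ p := by
  have h2 : j ≤ join {n | n ∈ N ∧ n < j} ⊔ p := by
    conv_lhs => rw [← h]
    refine join_le ?_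
    rintro s ⟨hs | rfl, hlt⟩
    · exact le_sup_of_le_left (le_join ⟨hs, hlt⟩)
    · exact le_sup_right
  refine ⟨?_, h2⟩
  by_contra hlt
  refine D.nested.join_lt_ne hj.1 (D.ne_bot (D.mem_G hj.1))
    (le_antisymm (join_le fun s hs => hs.2.le) ?_)
  conv_lhs => rw [← h]
  refine join_mono ?_
  rintro s ⟨hs | rfl, hs'⟩
  · exact ⟨hs, hs'⟩
  · exact absurd hs' hlt

/-- If adding `p` to `N` creates a bad join `j`, then `j` lies in the local interval of `p`. -/
theorem le_of_join_eq {p g j : L} (hg : g ∈ F) (hgn : g ∈ nonAtoms H) (hpg : p ≤ g)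
    (hj : j ∈ nonAtoms H) (h : join {s | s ∈ N ∪ {p} ∧ s < j} = j) :
    j ≤ g ∧ j ≤ p ⊔ base F g := by
  obtain ⟨-, h2⟩ := D.lt_of_join_eq hj h
  have h3 : j ≤ join ({n | n ∈ N ∧ n < j} ∪ {g}) :=
    h2.trans (sup_le (join_mono Set.subset_union_left) (hpg.trans (le_join (Or.inr rfl))))
  have hjg : j ≤ g := by
    obtain ⟨a, ha, hja⟩ := D.le_of_le_join (A := {n | n ∈ N ∧ n < j} ∪ {g}) D.nested (by
      rintro a (ha | rfl)
      · exact Or.inr ha.1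
      · exact D.mem_insert_of_mem_F hg hgn) hj h3
    rcases ha with ha | rfl
    · exact absurd ha.2 (not_lt_of_ge hja)
    · exact hja
  exact ⟨hjg, h2.trans (sup_le (le_sup_of_le_right
    (join_le fun a ha => D.le_base_of_mem ha.1 hg hgn (ha.2.trans_le hjg))) le_sup_left)⟩

/-- A bad join `j` created by `k` would satisfy `k < j ≤ k ⊔ z(g) ≤ w`, against the maximality of
`k`. -/
theorem mem_star_of_mem_factors {k g w : L} (hg : g ∈ F) (hk : k ∈ nonAtoms H) (hkg : k ≤ g)
    (hmax : k ∈ factors G w) (hw : base F g ≤ w) : k ∈ closedStar H N := by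
  have hgn := D.filter hk (D.F_mem_G hg) hkg
  refine ⟨hk.1, isNested_of_join_lt_ne D.bot_notMem
    (Set.union_subset D.nested.1 (Set.singleton_subset_iff.2 hk.1)) fun j hj h => ?_⟩
  have h1 := (D.lt_of_join_eq hj h).1
  have h2 := (D.le_of_join_eq hg hgn hkg hj h).2
  exact absurd h1 (not_lt_of_ge (hmax.2 ⟨D.mem_G hj.1,
    h2.trans (sup_le (le_of_mem_factors hmax) hw)⟩ h1.le))

/-- `a` lies below some `k` in `G` that is the join of those among `h` and the `f < g` which it
dominates. If `h` is among them, `k` is in H° and hence below `h` or z(g); if not, `k ≤ z(g)`. -/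
theorem le_of_le_star_sup_base {h a g : L} (hh : h ∈ closedStar H N) (hn : h ∈ nonAtoms H)
    (ha : a ∈ G) (hle : a ≤ h ⊔ base F g) (hb : ¬ a ≤ base F g) : a ≤ h := by
  have hle' : a ≤ join ({h} ∪ {f | f ∈ F ∧ f < g}) :=
    hle.trans (sup_le (le_join (Or.inl rfl)) (join_mono Set.subset_union_right))
  have hsup : join ({h} ∪ {f | f ∈ F ∧ f < g}) ≤ h ⊔ base F g := by
    refine join_le ?_
    rintro s (rfl | hs)
    · exact le_sup_left
    · exact le_sup_of_le_right (le_join hs)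
  obtain ⟨k, hk, hak, hjk⟩ := D.building.exists_join_eq (A := {h} ∪ {f | f ∈ F ∧ f < g}) (by
    rintro s (rfl | hs)
    · exact D.mem_G hh.1
    · exact D.F_mem_G hs.1) ha hle'
  by_cases hhk : h ≤ k
  · have hkle : k ≤ h ⊔ base F g := by
      rw [← hjk]
      exact (join_mono fun s hs => hs.1).trans hsup
    rcases D.le_of_le_sup_base hh (D.filter hn hk hhk) hkle with h1 | h1
    · exact hak.trans h1
    · exact absurd (hak.trans h1) hb
  · refine absurd (hak.trans ?_) hb
    rw [← hjk]
    refine join_le ?_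
    rintro s ⟨rfl | hs, hsk⟩
    · exact absurd hsk hhk
    · exact le_join hs

/-- A bad join `j` created by `a` lies below a join of members of `N` under `j`, the atom `p` and
z(g). It would then lie below one of these, and each case is impossible; the last because `a < j`
while `a` is not below z(g). -/
theorem mem_star_of_atom {a p g : L} (ha : IsAtom a) (hp : IsAtom p) (hpV : p ∈ closedStar H N)
    (hb : ¬ a ≤ base F g) (hle : a ≤ p ⊔ base F g) : a ∈ closedStar H N := by
  have haH := D.partialBuilding.atom_mem a ha
  refine ⟨haH, isNested_of_join_lt_ne D.bot_notMem
    (Set.union_subset D.nested.1 (Set.singleton_subset_iff.2 haH)) fun j hj h => ?_⟩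
  obtain ⟨h1, h2⟩ := D.lt_of_join_eq hj h
  have h3 : j ≤ join ({n | n ∈ N ∧ n < j} ∪ {p}) ⊔ base F g :=
    h2.trans (sup_le (le_sup_of_le_left (join_mono Set.subset_union_left))
      (hle.trans (sup_le_sup_right
        (le_join (A := {n | n ∈ N ∧ n < j} ∪ {p}) (Or.inr rfl)) _)))
  rcases D.le_of_le_join_sup_base hpV.2 Set.subset_union_left (A := {n | n ∈ N ∧ n < j} ∪ {p}) (by
      rintro s (hs | hs)
      · exact Or.inr (Or.inl hs.1)
      · exact Or.inr (Or.inr hs)) hj h3 with ⟨s, hs | rfl, hjs⟩ | h4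
  · exact absurd hs.2 (not_lt_of_ge hjs)
  · rcases hp.le_iff.1 hjs with h0 | h0
    · exact D.ne_bot (D.mem_G hj.1) h0
    · exact hj.2 (h0 ▸ hp)
  · exact hb (h1.le.trans h4)

/-- An atom outside the star creates a bad join `j` with `a < j ≤ a ⊔ z(g)`. A factor of `a ⊔ z(g)`
above `j` is in the star and has the same local image, so no atom of the interval is missed. -/
theorem exists_star_of_atom {a g : L} (ha : IsAtom a) (hat : IsHat F a g)
    (hgn : g ∈ nonAtoms H) (haV : a ∉ closedStar H N) :
    ∃ k ∈ closedStar H N, k ∈ nonAtoms H ∧ IsHat F k g ∧ k ⊔ base F g = a ⊔ base F g := by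
  have haH := D.partialBuilding.atom_mem a ha
  have hb := D.not_le_base_of_isHat (D.mem_G haH) hat
  have hex : ∃ j ∈ nonAtoms H, join {s | s ∈ N ∪ {a} ∧ s < j} = j := by
    by_contra hc
    push Not at hc
    exact haV ⟨haH, isNested_of_join_lt_ne D.bot_notMem
      (Set.union_subset D.nested.1 (Set.singleton_subset_iff.2 haH)) hc⟩
  obtain ⟨j, hj, h⟩ := hex
  have h1 := (D.lt_of_join_eq hj h).1
  have h2 := (D.le_of_join_eq hat.1.1 hgn hat.1.2 hj h).2
  obtain ⟨k, hk, hjk⟩ := exists_factor_ge (D.mem_G hj.1) h2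
  have hkn := D.filter hj (mem_of_mem_factors hk) hjk
  have hkg : k ≤ g := (le_of_mem_factors hk).trans (sup_le hat.1.2 (base_le F g))
  have hak := h1.le.trans hjk
  exact ⟨k, D.mem_star_of_mem_factors hat.1.1 hkn hkg hk le_sup_right, hkn,
    D.isHat_of_not_le_base (D.ne_bot (mem_of_mem_factors hk)) hat.1.1 hkg
      (fun h' => hb (hak.trans h')),
    le_antisymm (sup_le (le_of_mem_factors hk) le_sup_right) (sup_le_sup_right hak _)⟩

theorem eq_of_sup_base_eq {h h' g : L} (hh : h ∈ closedStar H N) (hh' : h' ∈ closedStar H N)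
    (hat : IsHat F h g) (hat' : IsHat F h' g) (hn : h ∈ nonAtoms H)
    (he : h ⊔ base F g = h' ⊔ base F g) : h = h' := by
  have h1 : h ≤ h' := (D.le_of_le_sup_base hh' hn (he ▸ le_sup_left)).resolve_right
    (D.not_le_base_of_isHat (D.mem_G hh.1) hat)
  have hn' := D.filter hn (D.mem_G hh'.1) h1
  exact le_antisymm h1 ((D.le_of_le_sup_base hh hn' (he ▸ le_sup_left)).resolve_right
    (D.not_le_base_of_isHat (D.mem_G hh'.1) hat'))

end StarDatum

/-! ### Local intervals -/

theorem isAtom_localInterval_iff {F : Set L} {g : L} (q : LocalInterval F g) :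
    IsAtom q ↔ base F g ⋖ (q : L) := by
  constructor
  · refine fun h => ⟨lt_of_le_of_ne q.2.1 fun e => h.1 (Subtype.ext e.symm), fun c hc hcq => ?_⟩
    have := h.2 ⟨c, hc.le, hcq.le.trans q.2.2⟩ hcq
    exact hc.ne (congrArg Subtype.val this).symm
  · refine fun h => ⟨fun e => h.1.ne (congrArg Subtype.val e).symm, fun b hb => ?_⟩
    by_contra hne
    exact h.2 (lt_of_le_of_ne b.2.1 fun e => hne (Subtype.ext e.symm)) hb

/-- Semimodularity enters here: it makes the local images of atoms atoms of the interval. -/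
theorem covBy_sup_of_isAtom [IsUpperModularLattice L] {a z : L} (ha : IsAtom a) (h : ¬ a ≤ z) :
    z ⋖ a ⊔ z := by
  refine IsUpperModularLattice.covBy_sup_of_inf_covBy ?_
  have h0 : a ⊓ z = ⊥ := (ha.le_iff.1 inf_le_left).resolve_right fun e => h (e ▸ inf_le_right)
  rw [h0]
  exact ha.bot_covBy

namespace StarDatum

variable [IsUpperModularLattice L] {G H N F : Set L} {x : L} (D : StarDatum G H N F x)
include D

theorem isAtom_of_eq_sup {p g : L} (hp : IsAtom p) (hat : IsHat F p g) {q : LocalInterval F g}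
    (hq : (q : L) = p ⊔ base F g) : IsAtom q := by
  rw [isAtom_localInterval_iff, hq]
  exact covBy_sup_of_isAtom hp
    (D.not_le_base_of_isHat (D.mem_G (D.partialBuilding.atom_mem p hp)) hat)

theorem exists_atom_of_lt {g : L} {q : LocalInterval F g} (hq : (q : L) ≠ base F g)
    (hg : g ∈ F) : ∃ a, IsAtom a ∧ a ≤ (q : L) ∧ IsHat F a g := by
  have : ∃ a, IsAtom a ∧ a ≤ (q : L) ∧ ¬ a ≤ base F g := by
    by_contra hc
    push Not at hc
    refine hq (le_antisymm ?_ q.2.1)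
    rw [eq_join_atoms (q : L)]
    exact join_le fun a ha => hc a ha.1 ha.2
  obtain ⟨a, ha, haq, hab⟩ := this
  exact ⟨a, ha, haq, D.isHat_of_not_le_base ha.1 hg (haq.trans q.2.2) hab⟩

theorem sup_base_eq_of_covBy {a z q : L} (hq : z ⋖ q) (haq : a ≤ q) (hb : ¬ a ≤ z) :
    a ⊔ z = q :=
  (hq.wcovBy.eq_or_eq le_sup_right (sup_le haq hq.le)).resolve_left
    fun h => hb (h ▸ le_sup_left)

/-- Every member of a local building set with non-atom top comes from the closed star. -/
theorem exists_star_eq {g : L} (hg : g ∈ F) (hgn : g ∈ nonAtoms H) {q : LocalInterval F g}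
    (hq : q ∈ localBuilding H N F g) :
    ∃ p ∈ closedStar H N, IsHat F p g ∧ (q : L) = p ⊔ base F g := by
  rcases hq with h | hq
  · exact h
  rw [isAtom_localInterval_iff] at hq
  obtain ⟨a, ha, haq, hat⟩ := D.exists_atom_of_lt hq.1.ne' hg
  have he := D.sup_base_eq_of_covBy hq haq
    (D.not_le_base_of_isHat (D.mem_G (D.partialBuilding.atom_mem a ha)) hat)
  by_cases haV : a ∈ closedStar H N
  · exact ⟨a, haV, hat, he.symm⟩
  · obtain ⟨k, hk, -, hkat, hke⟩ := D.exists_star_of_atom ha hat hgn haV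
    exact ⟨k, hk, hkat, he.symm.trans hke.symm⟩

/-- Several atoms may share a local image. Requiring the representative to lie above a fixed atom
`a` makes it unique (`eq_of_ge_atom`), which turns local sums into sums over the star. -/
theorem exists_star_eq_ge {a g : L} (ha : IsAtom a) (hat : IsHat F a g) (hgn : g ∈ nonAtoms H)
    {q : LocalInterval F g} (hq : q ∈ localBuilding H N F g) (haq : a ≤ (q : L)) :
    ∃ p ∈ closedStar H N, IsHat F p g ∧ a ≤ p ∧ (q : L) = p ⊔ base F g := by
  obtain ⟨p, hp, hpat, he⟩ := D.exists_star_eq hat.1.1 hgn hq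
  have haG := D.mem_G (D.partialBuilding.atom_mem a ha)
  have hb := D.not_le_base_of_isHat haG hat
  by_cases hn : p ∈ nonAtoms H
  · exact ⟨p, hp, hpat, D.le_of_le_star_sup_base hp hn haG (he ▸ haq) hb, he⟩
  · have hpa := D.atom_of_notMem hp.1 hn
    have hcov := (isAtom_localInterval_iff q).1 (D.isAtom_of_eq_sup hpa hpat he)
    exact ⟨a, D.mem_star_of_atom ha hpa hp hb (he ▸ haq), hat, le_rfl,
      (D.sup_base_eq_of_covBy hcov haq hb).symm⟩

theorem eq_of_ge_atom {a h h' g : L} (ha : IsAtom a) (hh : h ∈ closedStar H N)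
    (hh' : h' ∈ closedStar H N) (hat : IsHat F h g) (hat' : IsHat F h' g) (hah : a ≤ h)
    (hah' : a ≤ h') (he : h ⊔ base F g = h' ⊔ base F g) : h = h' := by
  by_cases hn : h ∈ nonAtoms H
  · exact D.eq_of_sup_base_eq hh hh' hat hat' hn he
  by_cases hn' : h' ∈ nonAtoms H
  · exact (D.eq_of_sup_base_eq hh' hh hat' hat hn' he.symm).symm
  have e1 := ((D.atom_of_notMem hh.1 hn).le_iff.1 hah).resolve_left ha.1
  have e2 := ((D.atom_of_notMem hh'.1 hn').le_iff.1 hah').resolve_left ha.1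
  exact e1.symm.trans e2

theorem isAtom_of_notMem_nonAtoms {g : L} (hgn : g ∉ nonAtoms H)
    {q : LocalInterval F g} (hq : q ∈ localBuilding H N F g) : IsAtom q := by
  rcases hq with ⟨p, hp, hat, he⟩ | hq
  · exact D.isAtom_of_eq_sup (D.atom_of_notMem hp.1 fun h =>
      hgn (D.filter h (D.F_mem_G hat.1.1) hat.1.2)) hat he
  · exact hq

/-- The images of a nested set in a local interval are nested. -/
theorem isNested_local {P : Set L} {g : L} (hP : P ⊆ closedStar H N)
    (hat : ∀ p ∈ P, IsHat F p g) (hN : IsNested H (N ∪ P)) :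
    IsNested (localBuilding H N F g)
      {q : LocalInterval F g | ∃ p ∈ P, (q : L) = p ⊔ base F g} := by
  refine isNested_of_not_isLUB_lt ?_ ?_
  · rintro q ⟨p, hp, he⟩
    exact Or.inl ⟨p, hP hp, hat p hp, he⟩
  intro κ hκ hl
  have hnat : ¬ IsAtom κ := by
    intro hκa
    refine hκa.1 (le_bot_iff.1 (hl.2 ?_))
    rintro s ⟨⟨p, hp, he⟩, hlt⟩
    exact (hκa.lt_iff.1 hlt).le
  obtain ⟨p, hp, hpat, he⟩ := hκ.resolve_right hnat
  have hn : p ∈ nonAtoms H := by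
    by_contra hn
    exact hnat (D.isAtom_of_eq_sup (D.atom_of_notMem hp.1 hn) hpat he)
  set P' := {p' | p' ∈ P ∧ p' ⊔ base F g < κ} with hP'
  have hle : (κ : L) ≤ join P' ⊔ base F g := by
    have hm : join P' ⊔ base F g ≤ g :=
      sup_le (join_le fun p' hp' => (hat p' hp'.1).1.2) (base_le F g)
    have : κ ≤ (⟨join P' ⊔ base F g, le_sup_right, hm⟩ : LocalInterval F g) := by
      refine hl.2 ?_
      rintro s ⟨⟨p', hp', hs⟩, hlt⟩
      have hlt' : (s : L) < κ := hlt
      show (s : L) ≤ _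
      rw [hs] at hlt' ⊢
      exact sup_le_sup_right (le_join (A := P') ⟨hp', hlt'⟩) _
    exact this
  have hple : p ≤ join P' ⊔ base F g := le_trans (he ▸ le_sup_left) hle
  rcases D.le_of_le_join_sup_base hN Set.subset_union_left
    (fun p' hp' => Or.inr (Or.inr hp'.1)) hn hple with ⟨p', hp', h⟩ | h
  · exact absurd hp'.2 (not_lt_of_ge (he.le.trans (sup_le_sup_right h _)))
  · exact D.not_le_base_of_isHat (D.mem_G hp.1) hpat h

/-- A subset of the closed star is nested if all its local images are. -/
theorem isNested_of_local {T : Set L} (hT : T ⊆ closedStar H N)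
    (hloc : ∀ g ∈ F, g ∈ nonAtoms H → IsNested (localBuilding H N F g)
      {q : LocalInterval F g | ∃ p ∈ T, IsHat F p g ∧ (q : L) = p ⊔ base F g}) :
    IsNested H (N ∪ T) := by
  refine isNested_of_join_lt_ne D.bot_notMem
    (Set.union_subset D.nested.1 fun p hp => (hT hp).1) fun j hj h => ?_
  set A := {s | s ∈ N ∪ T ∧ s < j} with hA
  have hAV : ∀ a ∈ A, a ∈ closedStar H N := by
    rintro a ⟨ha | ha, -⟩
    · exact D.mem_star_of_mem ha
    · exact hT ha
  -- Each `a` is enlarged to its hat when that is in H°, and otherwise kept, being then an atom of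
  -- `N`. All the new elements lie in `N ∪ {⊤}`, so `j` falls below one of them, and this must be a
  -- hat `g`.
  have hB : j ≤ join {b | b ∈ insert ⊤ N ∧ ∃ a ∈ A, (b = a ∨ (b ∈ nonAtoms H ∧ IsHat F a b))} := by
    conv_lhs => rw [← h]
    refine join_le fun a ha => ?_
    have haG := D.mem_G (hAV a ha).1
    obtain ⟨g, hg⟩ := D.exists_isHat (D.ne_bot haG)
    by_cases hgn : g ∈ nonAtoms H
    · exact hg.1.2.trans (le_join ⟨D.mem_insert_of_mem_F hg.1.1 hgn, a, ha, Or.inr ⟨hgn, hg⟩⟩)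
    · have hgt : g ≠ ⊤ := by
        rintro rfl
        exact hgn (D.filter hj D.top_mem le_top)
      have hax := hg.1.2.trans (le_of_mem_factors (D.mem_factors_of_mem_F hg.1.1 hgn hgt))
      have hat := D.atom_of_notMem (hAV a ha).1
        (fun h => hgn (D.filter h (D.F_mem_G hg.1.1) hg.1.2))
      exact le_join ⟨Or.inr ((D.atom_mem_iff a hat).2 hax), a, ha, Or.inl rfl⟩
  obtain ⟨g, ⟨-, a, ha, hag⟩, hjg⟩ := D.le_of_le_join D.nested (fun b hb => hb.1) hj hB
  obtain ⟨hgn, hat⟩ := hag.resolve_left fun e => absurd ha.2 (not_lt_of_ge (e ▸ hjg))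
  have hgF := hat.1.1
  have hab := D.not_le_base_of_isHat (D.mem_G (hAV a ha).1) hat
  -- `j` itself may fail to be in the star; the factor `k` of `j ⊔ z(g)` above it is in the star and
  -- has the same local image. That image will be a forbidden local join.
  obtain ⟨k, hk, hjk⟩ := exists_factor_ge (D.mem_G hj.1) (le_sup_left : j ≤ j ⊔ base F g)
  have hkn := D.filter hj (mem_of_mem_factors hk) hjk
  have hkg : k ≤ g := (le_of_mem_factors hk).trans (sup_le hjg (base_le F g))
  have hkb : ¬ k ≤ base F g := fun h' => hab (ha.2.le.trans (hjk.trans h'))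
  have hkV := D.mem_star_of_mem_factors hgF hkn hkg hk le_sup_right
  have hkat := D.isHat_of_not_le_base (D.ne_bot (mem_of_mem_factors hk)) hgF hkg hkb
  have hkj : k ⊔ base F g = j ⊔ base F g :=
    le_antisymm (sup_le (le_of_mem_factors hk) le_sup_right) (sup_le_sup_right hjk _)
  let κ : LocalInterval F g := ⟨k ⊔ base F g, le_sup_right, sup_le hkg (base_le F g)⟩
  refine (hloc g hgF hgn).not_isLUB_lt (k := κ) (Or.inl ⟨k, hkV, hkat, rfl⟩) ?_ ?_
  · exact fun hb => hkb (le_trans le_sup_left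
      (show k ⊔ base F g ≤ base F g from hb ⟨base F g, le_rfl, base_le F g⟩))
  refine ⟨fun s hs => hs.2.le, fun b hb => ?_⟩
  show k ⊔ base F g ≤ (b : L)
  rw [hkj]
  refine sup_le ?_ b.2.1
  conv_lhs => rw [← h]
  refine join_le fun a' ha' => ?_
  by_cases hb' : a' ≤ base F g
  · exact hb'.trans b.2.1
  have ha'g : a' ≤ g := ha'.2.le.trans hjg
  have hat' := D.isHat_of_not_le_base (D.ne_bot (D.mem_G (hAV a' ha').1)) hgF ha'g hb'
  have ha'T : a' ∈ T := ha'.1.resolve_left fun hN =>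
    hb' (D.le_base_of_mem hN hgF hgn (ha'.2.trans_le hjg))
  have hlt : a' ⊔ base F g < k ⊔ base F g := by
    refine lt_of_le_not_ge (sup_le_sup_right (ha'.2.le.trans hjk) _) fun hge => ?_
    rcases D.le_of_le_sup_base (hAV a' ha') hkn (le_sup_left.trans hge) with h1 | h1
    · exact absurd ha'.2 (not_lt_of_ge (hjk.trans h1))
    · exact hkb h1
  have := hb (a := (⟨a' ⊔ base F g, le_sup_right, sup_le ha'g (base_le F g)⟩ : LocalInterval F g))
    ⟨⟨a', ha'T, hat', rfl⟩, hlt⟩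
  exact le_sup_left.trans (show a' ⊔ base F g ≤ (b : L) from this)

end StarDatum

/-! ### Supports -/

/-- The support of the element of the blowup whose join decomposition is the nested set `S`. -/
def support (H S : Set L) : Set L :=
  {h | h ∈ S ∧ h ∈ nonAtoms H} ∪ {a | IsAtom a ∧ a ≤ join {b | b ∈ S ∧ IsAtom b}}

theorem subset_support {H S : Set L} (hS : S ⊆ H) : S ⊆ support H S := by
  intro h hh
  by_cases ha : IsAtom h
  · exact Or.inr ⟨ha, le_join ⟨hh, ha⟩⟩
  · exact Or.inl ⟨hh, hS hh, ha⟩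

/-- The atoms added to `S` are bounded by the join of the atoms of `S`. A bad join would thus lie
below an atom of `S` or below a member of `S ∪ T` strictly under it. Hence the local algebra of `S`
can be studied with the full support instead. -/
theorem isNested_support_union {G H : Set L} (hG : IsBuildingSet G)
    (hH : IsPartialBuildingSet G H) {S T : Set L} (h : IsNested H (S ∪ T)) :
    IsNested H (support H S ∪ T) := by
  have hbot : ⊥ ∉ H := fun h => hG.ne_bot (hH.subset h) rfl
  refine isNested_of_join_lt_ne hbot ?_ ?_
  · rintro s ((hs | hs) | hs)
    · exact hs.2.1
    · exact hH.atom_mem s hs.1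
    · exact h.1 (Or.inr hs)
  intro j hj hjoin
  have hle : j ≤ join ({b | b ∈ S ∧ IsAtom b} ∪ {s | s ∈ S ∪ T ∧ s < j}) := by
    conv_lhs => rw [← hjoin]
    refine join_le ?_
    rintro s ⟨(hs | hs) | hs, hlt⟩
    · exact le_join (Or.inr ⟨Or.inl hs.1, hlt⟩)
    · exact hs.2.trans (join_mono Set.subset_union_left)
    · exact le_join (Or.inr ⟨Or.inr hs, hlt⟩)
  obtain ⟨a, ha | ha, hja⟩ := hH.le_of_le_join hG h
    (A := {b | b ∈ S ∧ IsAtom b} ∪ {s | s ∈ S ∪ T ∧ s < j}) (by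
      rintro s (hs | hs)
      · exact Or.inr (Or.inl hs.1)
      · exact Or.inr hs.1) hj hle
  · rcases ha.2.le_iff.1 hja with h0 | h0
    · exact hG.ne_bot (hH.subset hj.1) h0
    · exact hj.2 (h0 ▸ ha.2)
  · exact absurd ha.2 (not_lt_of_ge hja)

end Star

/-! ### Coordinates on iterated blowups -/

section Coordinates

variable {L : Type u} [Lattice L] [BoundedOrder L]

/-- Coordinates on a sequence of blowups at the elements of `P`: an order isomorphism `ε` onto a
lower set of `Set L × L`, with `p ↦ ({p}, ⊥)` for the elements `p` blown up and `g ↦ (∅, g)` for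
the surviving elements `g`. -/
structure Stage.IsCoord (s : Stage L) (P : Set L) (ε : s.carrier → Set L × L) : Prop where
  le_iff : ∀ a b, a ≤ b ↔ ε a ≤ ε b
  lower : ∀ a c, c ≤ ε a → ∃ b, ε b = c
  nonempty : Nonempty s.carrier
  fst_subset : ∀ a, (ε a).1 ⊆ P
  elt_of_mem : ∀ g ∈ P, ∃ v, s.elt g = some v ∧ ε v = ({g}, ⊥)
  elt_of_notMem : ∀ g, (∀ p ∈ P, ¬ p ≤ g) → ∃ v, s.elt g = some v ∧ ε v = (∅, g)

theorem Stage.isCoord_init : (Stage.init L).IsCoord ∅ (fun x : L => ((∅ : Set L), x)) where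
  le_iff a b := by
    exact ⟨fun h => ⟨le_rfl, h⟩, fun h => h.2⟩
  lower a c h := ⟨c.2, Prod.ext (Set.subset_empty_iff.1 h.1).symm rfl⟩
  nonempty := ⟨(⊥ : L)⟩
  fst_subset _ := le_rfl
  elt_of_mem g hg := absurd hg (Set.notMem_empty g)
  elt_of_notMem g _ := ⟨g, rfl, rfl⟩

open Classical in
theorem Stage.blowup_eq {s : Stage L} {p : L} {q : s.carrier} (h : s.elt p = some q) :
    s.blowup p =
      { carrier := Bl q
        order := inferInstance
        down := fun u => s.down u.down
        elt := fun g => if g = p then Bl.new? q else (s.elt g).bind (Bl.old? q) } := by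
  unfold Stage.blowup
  rw [h]

/-- No earlier centre lies below `p`, so `p` still has coordinates (∅, p), and lying above it is a
condition on the second coordinate only. -/
theorem Stage.IsCoord.exists_blowup {s : Stage L} {P : Set L} {ε : s.carrier → Set L × L}
    (hε : s.IsCoord P ε) {p : L} (hp0 : p ≠ ⊥) (hp : ∀ p' ∈ P, ¬ p' ≤ p) :
    ∃ ε', (s.blowup p).IsCoord (insert p P) ε' := by
  classical
  obtain ⟨q, hq, hεq⟩ := hε.elt_of_notMem p hp
  rw [Stage.blowup_eq hq]
  have hpP : p ∉ P := fun h => hp p h le_rfl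
  have hqle : ∀ v, q ≤ v ↔ p ≤ (ε v).2 := fun v => by
    rw [hε.le_iff, hεq]
    exact ⟨fun h => h.2, fun h => ⟨Set.empty_subset _, h⟩⟩
  -- Because the image of `ε` is a lower set, joins of bounded pairs exist and are computed in
  -- coordinates.
  have hlub : ∀ v w, v ≤ w → q ≤ w → ∃ b, IsLUB {q, v} b := by
    intro v w hvw hqw
    obtain ⟨b, hb⟩ := hε.lower w (ε q ⊔ ε v)
      (sup_le ((hε.le_iff _ _).1 hqw) ((hε.le_iff _ _).1 hvw))
    refine ⟨b, ?_, fun c hc => ?_⟩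
    · rintro c (rfl | rfl)
      · rw [hε.le_iff, hb]; exact le_sup_left
      · rw [hε.le_iff, hb]; exact le_sup_right
    · rw [hε.le_iff, hb]
      exact sup_le ((hε.le_iff _ _).1 (hc (Or.inl rfl))) ((hε.le_iff _ _).1 (hc (Or.inr rfl)))
  obtain ⟨o, ho⟩ : ∃ o, ε o = (∅, ⊥) := by
    obtain ⟨a⟩ := hε.nonempty
    exact hε.lower a _ ⟨Set.empty_subset _, bot_le⟩
  have hqo : ¬ q ≤ o := by
    rw [hqle, ho]
    exact fun h => hp0 (le_bot_iff.1 h)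
  have hoq : o ≤ q := by
    rw [hε.le_iff, ho]
    exact ⟨Set.empty_subset _, bot_le⟩
  -- Passing from x to (p, x) adjoins `p` to the first coordinate and keeps the second.
  let ε' : Bl q → Set L × L := fun u =>
    (if u.1.2 = true then insert p (ε u.1.1).1 else (ε u.1.1).1, (ε u.1.1).2)
  have hε't : ∀ u : Bl q, u.1.2 = true → ε' u = (insert p (ε u.1.1).1, (ε u.1.1).2) :=
    fun u hu => by simp only [ε', hu, if_true]
  have hε'f : ∀ u : Bl q, u.1.2 = false → ε' u = ε u.1.1 :=
    fun u hu => by simp [ε', hu]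
  have hpn : ∀ v, p ∉ (ε v).1 := fun v h => hpP (hε.fst_subset v h)
  refine ⟨ε', ⟨?_, ?_, ?_, ?_, ?_, ?_⟩⟩
  · intro a b
    have hab : a ≤ b ↔ a.1.1 ≤ b.1.1 ∧ a.1.2 ≤ b.1.2 := Iff.rfl
    change a ≤ b ↔ _
    rw [hab, hε.le_iff]
    cases ha : a.1.2 <;> cases hb : b.1.2
    · rw [hε'f a ha, hε'f b hb]; simp
    · rw [hε'f a ha, hε't b hb]
      refine ⟨fun h => ⟨h.1.1.trans (Set.subset_insert _ _), h.1.2⟩, fun h => ⟨⟨?_, h.2⟩, by simp⟩⟩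
      exact (Set.subset_insert_iff_of_notMem (hpn _)).1 h.1
    · rw [hε't a ha, hε'f b hb]
      refine ⟨fun h => absurd h.2 (by simp), fun h => absurd (h.1 (Set.mem_insert _ _)) (hpn _)⟩
    · rw [hε't a ha, hε't b hb]
      refine ⟨fun h => ⟨Set.insert_subset_insert h.1.1, h.1.2⟩, fun h => ⟨⟨?_, h.2⟩, le_rfl⟩⟩
      exact (Set.insert_subset_insert_iff (hpn _)).1 h.1
  · intro a c hc
    have hc2 : c.2 ≤ (ε a.1.1).2 := hc.2
    have hc1 : c.1 \ {p} ⊆ (ε a.1.1).1 := by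
      intro t ht
      have h1 := hc.1 ht.1
      cases ha : a.1.2
      · rwa [hε'f a ha] at h1
      · rw [hε't a ha] at h1
        exact h1.resolve_left ht.2
    obtain ⟨v, hv⟩ := hε.lower a.1.1 (c.1 \ {p}, c.2) ⟨hc1, hc2⟩
    have hva : v ≤ a.1.1 := by rw [hε.le_iff, hv]; exact ⟨hc1, hc2⟩
    have hqv : ¬ q ≤ v := fun h => a.2.1 (h.trans hva)
    by_cases hpc : p ∈ c.1
    · have hat : a.1.2 = true := by
        by_contra ha
        have h1 := hc.1 hpc
        rw [hε'f a (by simpa using ha)] at h1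
        exact hpn _ h1
      obtain ⟨w, hw⟩ := a.2.2 hat
      refine ⟨⟨(v, true), hqv, fun _ => hlub v w (hva.trans (hw.1 (Or.inr rfl)))
        (hw.1 (Or.inl rfl))⟩, ?_⟩
      refine Eq.trans (hε't _ ?_) ?_
      · rfl
      refine Prod.ext ?_ ?_
      · show insert p (ε v).1 = c.1
        rw [hv]
        exact Set.insert_sdiff_self_of_mem hpc
      · show (ε v).2 = c.2
        rw [hv]
    · refine ⟨⟨(v, false), hqv, fun h => by simp at h⟩, ?_⟩
      refine Eq.trans (hε'f _ ?_) ?_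
      · rfl
      show ε v = c
      rw [hv]
      exact Prod.ext (Set.sdiff_singleton_eq_self hpc) rfl
  · exact ⟨⟨(o, false), hqo, fun h => by simp at h⟩⟩
  · intro a
    cases ha : a.1.2
    · rw [hε'f a ha]
      exact (hε.fst_subset _).trans (Set.subset_insert _ _)
    · rw [hε't a ha]
      exact Set.insert_subset_insert (hε.fst_subset _)
  · intro g hg
    show ∃ v, (if g = p then Bl.new? q else (s.elt g).bind (Bl.old? q)) = some v ∧ _
    by_cases hgp : g = p
    · subst hgp
      rw [if_pos rfl]
      have hbot : IsBot o := fun v => by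
        rw [hε.le_iff, ho]
        exact ⟨Set.empty_subset _, bot_le⟩
      have hex : ∃ b : Bl q, b.1.2 = true ∧ IsBot b.1.1 :=
        ⟨⟨(o, true), hqo, fun _ => hlub o q hoq le_rfl⟩, rfl, hbot⟩
      refine ⟨hex.choose, dif_pos hex, ?_⟩
      have h1 := hex.choose_spec
      have h2 : hex.choose.1.1 = o := le_antisymm (h1.2 o) (hbot _)
      rw [hε't _ h1.1, h2, ho]
      simp
    · rw [if_neg hgp]
      obtain ⟨v, hv, hvε⟩ := hε.elt_of_mem g (hg.resolve_left hgp)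
      have hqv : ¬ q ≤ v := by
        rw [hqle, hvε]
        exact fun h => hp0 (le_bot_iff.1 h)
      refine ⟨⟨(v, false), hqv, fun h => by simp at h⟩, ?_, ?_⟩
      · rw [hv]
        exact dif_pos hqv
      · refine Eq.trans (hε'f _ ?_) hvε
        rfl
  · intro g hg
    show ∃ v, (if g = p then Bl.new? q else (s.elt g).bind (Bl.old? q)) = some v ∧ _
    have hgp : g ≠ p := by
      rintro rfl
      exact hg g (Or.inl rfl) le_rfl
    rw [if_neg hgp]
    obtain ⟨v, hv, hvε⟩ := hε.elt_of_notMem g fun p' hp' => hg p' (Or.inr hp')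
    have hqv : ¬ q ≤ v := by
      rw [hqle, hvε]
      exact hg p (Or.inl rfl)
    refine ⟨⟨(v, false), hqv, fun h => by simp at h⟩, ?_, ?_⟩
    · rw [hv]
      exact dif_pos hqv
    · refine Eq.trans (hε'f _ ?_) hvε
      rfl

theorem Stage.IsCoord.exists_foldl (l : List L) : ∀ {s : Stage L} {P : Set L}
    {ε : s.carrier → Set L × L}, s.IsCoord P ε → l.Pairwise (fun p q => ¬ p ≤ q) →
    (∀ p ∈ l, p ≠ ⊥ ∧ ∀ p' ∈ P, ¬ p' ≤ p) →
    ∃ ε', (l.foldl Stage.blowup s).IsCoord (P ∪ {p | p ∈ l}) ε' := by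
  induction l with
  | nil =>
    intro s P ε hε _ _
    refine ⟨ε, ?_⟩
    simpa using hε
  | cons p l ih =>
    intro s P ε hε hl hP
    obtain ⟨hpl, hl'⟩ := List.pairwise_cons.1 hl
    obtain ⟨ε₁, hε₁⟩ := hε.exists_blowup (hP p (by simp)).1 (hP p (by simp)).2
    obtain ⟨ε₂, hε₂⟩ := ih hε₁ hl' (fun r hr => ⟨(hP r (by simp [hr])).1, by
      rintro p' (rfl | hp')
      · exact hpl r hr
      · exact (hP r (by simp [hr])).2 p' hp'⟩)
    refine ⟨ε₂, ?_⟩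
    have hset : P ∪ {r | r ∈ p :: l} = insert p P ∪ {r | r ∈ l} := by
      ext r
      simp only [Set.mem_union, Set.mem_ofPred_eq, List.mem_cons, Set.mem_insert_iff]
      tauto
    rw [hset]
    exact hε₂

theorem Stage.IsPartialBlowup.exists_isCoord {s : Stage L} {H : Set L}
    (hs : s.IsPartialBlowup H) (hbot : ⊥ ∉ H) : ∃ ε, s.IsCoord (nonAtoms H) ε := by
  obtain ⟨l, hl, hpw, rfl⟩ := hs
  obtain ⟨ε, hε⟩ := Stage.IsCoord.exists_foldl l Stage.isCoord_init hpw (fun p hp =>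
    ⟨fun h => hbot (h ▸ ((hl p).1 hp).1), fun p' hp' => absurd hp' (Set.notMem_empty p')⟩)
  refine ⟨ε, ?_⟩
  have hset : (∅ : Set L) ∪ {p | p ∈ l} = nonAtoms H := by
    ext p
    simp [hl]
  rw [hset] at hε
  exact hε

variable [Finite L] [IsAtomistic L]

/-- The support and the set `F⁺(y)` of the element `y = ⋁ S` of the partial blowup. -/
theorem Stage.IsPartialBlowup.supp_eq {G H : Set L} (hG : IsBuildingSet G) (hG_top : ⊤ ∈ G)
    (hH : IsPartialBuildingSet G H) {s : Stage L} (hs : s.IsPartialBlowup H) {y : s.carrier}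
    {S : Set L} (hS : IsNested H S) (hSy : IsLUB {v | ∃ h ∈ S, s.elt h = some v} y) :
    s.supp H y = support H S ∧
      StarDatum G H (s.supp H y) (s.factorsPlus G y) (join {b | b ∈ S ∧ IsAtom b}) := by
  have hbot : ⊥ ∉ H := fun h => hG.bot_notMem (hH.subset h)
  obtain ⟨ε, hε⟩ := hs.exists_isCoord hbot
  set x := join {b | b ∈ S ∧ IsAtom b}
  -- H° is a filter in `G`, so nothing blown up lies below a member of `G ∖ H°`.
  have hsurv : ∀ g ∈ G, g ∉ nonAtoms H → ∃ v, s.elt g = some v ∧ ε v = (∅, g) :=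
    fun g hg hn => hε.elt_of_notMem g fun p hp hpg => hn (hH.filter p hp g hg hpg)
  have hatn : ∀ a, IsAtom a → a ∉ nonAtoms H := fun a ha h => h.2 ha
  have hεy : ε y = ({h | h ∈ S ∧ h ∈ nonAtoms H}, x) := by
    have hle : ({h | h ∈ S ∧ h ∈ nonAtoms H}, x) ≤ ε y := by
      constructor
      · rintro h ⟨hh, hn⟩
        obtain ⟨v, hv, hvε⟩ := hε.elt_of_mem h hn
        have := ((hε.le_iff _ _).1 (hSy.1 ⟨h, hh, hv⟩)).1
        rw [hvε] at this
        exact this rfl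
      · refine join_le fun b hb => ?_
        obtain ⟨v, hv, hvε⟩ := hsurv b (hH.subset (hS.1 hb.1)) (hatn b hb.2)
        have := ((hε.le_iff _ _).1 (hSy.1 ⟨b, hb.1, hv⟩)).2
        rwa [hvε] at this
    -- The expected pair is below `ε y`, hence is the coordinate of some `w`. This `w` bounds all
    -- the atoms named by `S`, so `y ≤ w`.
    obtain ⟨w, hw⟩ := hε.lower y _ hle
    refine le_antisymm ?_ hle
    rw [← hw, ← hε.le_iff]
    refine hSy.2 ?_
    rintro v ⟨h, hh, hv⟩
    rw [hε.le_iff, hw]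
    by_cases hn : h ∈ nonAtoms H
    · obtain ⟨v', hv', hvε⟩ := hε.elt_of_mem h hn
      obtain rfl : v = v' := Option.some.inj (hv.symm.trans hv')
      rw [hvε]
      exact ⟨Set.singleton_subset_iff.2 ⟨hh, hn⟩, bot_le⟩
    · have hat : IsAtom h := by
        by_contra hc
        exact hn ⟨hS.1 hh, hc⟩
      obtain ⟨v', hv', hvε⟩ := hsurv h (hH.subset (hS.1 hh)) hn
      obtain rfl : v = v' := Option.some.inj (hv.symm.trans hv')
      rw [hvε]
      exact ⟨Set.empty_subset _, le_join ⟨hh, hat⟩⟩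
  have hley : ∀ v, v ≤ y ↔ (ε v).1 ⊆ {h | h ∈ S ∧ h ∈ nonAtoms H} ∧ (ε v).2 ≤ x := fun v => by
    rw [hε.le_iff, hεy]
    exact Iff.rfl
  have hn_iff : ∀ h ∈ nonAtoms H, (∃ v, s.elt h = some v ∧ v ≤ y) ↔ h ∈ S := by
    intro h hh
    obtain ⟨v, hv, hvε⟩ := hε.elt_of_mem h hh
    constructor
    · rintro ⟨v', hv', hle⟩
      obtain rfl : v' = v := Option.some.inj (hv'.symm.trans hv)
      rw [hley, hvε] at hle
      exact (hle.1 rfl).1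
    · intro hhS
      refine ⟨v, hv, ?_⟩
      rw [hley, hvε]
      exact ⟨Set.singleton_subset_iff.2 ⟨hhS, hh⟩, bot_le⟩
  have ha_iff : ∀ g ∈ G, g ∉ nonAtoms H → ((∃ v, s.elt g = some v ∧ v ≤ y) ↔ g ≤ x) := by
    intro g hg hn
    obtain ⟨v, hv, hvε⟩ := hsurv g hg hn
    constructor
    · rintro ⟨v', hv', hle⟩
      obtain rfl : v' = v := Option.some.inj (hv'.symm.trans hv)
      rw [hley, hvε] at hle
      exact hle.2
    · intro hgx
      refine ⟨v, hv, ?_⟩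
      rw [hley, hvε]
      exact ⟨Set.empty_subset _, hgx⟩
  have hsupp : s.supp H y = support H S := by
    ext h
    constructor
    · rintro ⟨hhH, hh⟩
      by_cases hn : h ∈ nonAtoms H
      · exact Or.inl ⟨(hn_iff h hn).1 hh, hn⟩
      · refine Or.inr ⟨?_, (ha_iff h (hH.subset hhH) hn).1 hh⟩
        by_contra hc
        exact hn ⟨hhH, hc⟩
    · rintro (⟨hhS, hn⟩ | ⟨hat, hle⟩)
      · exact ⟨hn.1, (hn_iff h hn).2 hhS⟩
      · exact ⟨hH.atom_mem h hat, (ha_iff h (hH.subset (hH.atom_mem h hat)) (hatn h hat)).2 hle⟩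
  refine ⟨hsupp, ?_⟩
  rw [hsupp]
  have hnest : IsNested H (support H S) := by
    have := isNested_support_union hG hH (S := S) (T := ∅) (by simpa using hS)
    simpa using this
  have hxle : ∀ g ∈ nonAtoms H, ¬ g ≤ x := by
    intro g hg hle
    obtain ⟨a, ha, hga⟩ := hH.le_of_le_join hG hS (A := {b | b ∈ S ∧ IsAtom b})
      (fun b hb => Or.inr hb.1) hg hle
    rcases ha.2.le_iff.1 hga with h0 | h0
    · exact hbot (h0 ▸ hg.1)
    · exact hg.2 (h0 ▸ ha.2)
  refine ⟨hG, hG_top, hH, hnest, ?_, ?_⟩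
  · intro a ha
    exact ⟨fun h => h.elim (fun h => absurd ha h.2.2) fun h => h.2, fun h => Or.inr ⟨ha, h⟩⟩
  -- In coordinates, members of H° become ({f}, ⊥) and members of `G ∖ H°` become (∅, f) with f ≠ ⊥.
  -- The former are incomparable with all others, hence all maximal below `y`; among the latter the
  -- maximal ones are the factors of `x`.
  intro f
  rw [or_comm]
  refine or_congr ?_ Iff.rfl
  constructor
  · rintro ⟨hf, v, hv, hmax⟩
    have hfy : ∃ v, s.elt f = some v ∧ v ≤ y := ⟨v, hv, hmax.1.2⟩
    by_cases hn : f ∈ nonAtoms H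
    · exact Or.inl ⟨Or.inl ⟨(hn_iff f hn).1 hfy, hn⟩, hn⟩
    · refine Or.inr ⟨⟨hf, (ha_iff f hf hn).1 hfy⟩, ?_⟩
      rintro g ⟨hg, hgx⟩ hfg
      have hgn : g ∉ nonAtoms H := fun h => hxle g h hgx
      obtain ⟨w, hw, hwy⟩ := (ha_iff g hg hgn).2 hgx
      obtain ⟨v', hv', hvε⟩ := hsurv f hf hn
      obtain rfl : v = v' := Option.some.inj (hv.symm.trans hv')
      obtain ⟨w', hw', hwε⟩ := hsurv g hg hgn
      obtain rfl : w = w' := Option.some.inj (hw.symm.trans hw')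
      have h1 : w ≤ v := hmax.2 ⟨⟨g, hg, hw⟩, hwy⟩ (by
        rw [hε.le_iff, hvε, hwε]
        exact ⟨le_rfl, hfg⟩)
      rw [hε.le_iff, hvε, hwε] at h1
      exact h1.2
  · rintro (⟨hf, hn⟩ | hf)
    · have hfS : f ∈ S := hf.elim (fun h => h.1) fun h => absurd h.1 hn.2
      obtain ⟨v, hv, hvε⟩ := hε.elt_of_mem f hn
      have hvy : v ≤ y := by
        rw [hley, hvε]
        exact ⟨Set.singleton_subset_iff.2 ⟨hfS, hn⟩, bot_le⟩
      refine ⟨hH.subset hn.1, v, hv, ⟨⟨f, hH.subset hn.1, hv⟩, hvy⟩, ?_⟩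
      rintro w ⟨⟨g, hg, hw⟩, hwy⟩ hvw
      rw [hε.le_iff, hvε] at hvw
      rw [hε.le_iff, hvε]
      by_cases hgn : g ∈ nonAtoms H
      · obtain ⟨w', hw', hwε⟩ := hε.elt_of_mem g hgn
        obtain rfl : w = w' := Option.some.inj (hw.symm.trans hw')
        rw [hwε] at hvw ⊢
        have : f = g := hvw.1 rfl
        rw [this]
      · obtain ⟨w', hw', hwε⟩ := hsurv g hg hgn
        obtain rfl : w = w' := Option.some.inj (hw.symm.trans hw')
        rw [hwε] at hvw
        exact absurd (hvw.1 rfl) (Set.notMem_empty f)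
    · have hn : f ∉ nonAtoms H := fun h => hxle f h hf.1.2
      obtain ⟨v, hv, hvε⟩ := hsurv f hf.1.1 hn
      have hvy : v ≤ y := by
        rw [hley, hvε]
        exact ⟨Set.empty_subset _, hf.1.2⟩
      refine ⟨hf.1.1, v, hv, ⟨⟨f, hf.1.1, hv⟩, hvy⟩, ?_⟩
      rintro w ⟨⟨g, hg, hw⟩, hwy⟩ hvw
      rw [hε.le_iff, hvε] at hvw
      rw [hε.le_iff, hvε]
      by_cases hgn : g ∈ nonAtoms H
      · obtain ⟨w', hw', hwε⟩ := hε.elt_of_mem g hgn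
        obtain rfl : w = w' := Option.some.inj (hw.symm.trans hw')
        rw [hwε] at hvw
        exact absurd (le_bot_iff.1 hvw.2) (hG.ne_bot hf.1.1)
      · obtain ⟨w', hw', hwε⟩ := hsurv g hg hgn
        obtain rfl : w = w' := Option.some.inj (hw.symm.trans hw')
        rw [hley] at hwy
        rw [hwε] at hvw hwy ⊢
        exact ⟨le_rfl, hf.2 ⟨hg, hwy.2⟩ hvw.2⟩

end Coordinates

/-! ### De Concini–Procesi algebras by generators and relations -/

section Presentation

variable {α : Type u} [PartialOrder α] [OrderBot α]

/-- The generator `x_h`. -/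
def LocalDP.var (H S : Set α) (h : H) : LocalDP H S := LocalDP.mk H S (MvPolynomial.X h)

theorem linElt_eq_finsum_mem (H : Set α) (g : α) :
    linElt H g = ∑ᶠ h ∈ {h : H | g ≤ (h : α)}, MvPolynomial.X h := rfl

theorem LocalDP.prod_var_eq_zero {H S : Set α} {T : Finset H}
    (hT : ¬ IsNested H (S ∪ Subtype.val '' (T : Set H))) : ∏ h ∈ T, LocalDP.var H S h = 0 := by
  have h : LocalDP.mk H S (∏ h ∈ T, MvPolynomial.X h) = 0 :=
    Ideal.Quotient.eq_zero_iff_mem.2 (Ideal.subset_span (Or.inl ⟨T, hT, rfl⟩))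
  rw [← h]
  exact (map_prod (Ideal.Quotient.mk (localIdeal H S)) _ _).symm

variable [Finite α]

theorem LocalDP.mk_linElt (H S : Set α) (g : α) :
    LocalDP.mk H S (linElt H g) = ∑ᶠ h ∈ {h : H | g ≤ (h : α)}, LocalDP.var H S h := by
  rw [linElt_eq_finsum_mem]
  exact (Ideal.Quotient.mk (localIdeal H S)).toAddMonoidHom.map_finsum_mem _ (Set.toFinite _)

theorem LocalDP.sum_var_eq_zero (H S : Set α) {a : α} (ha : IsAtom a) :
    ∑ᶠ h ∈ {h : H | a ≤ (h : α)}, LocalDP.var H S h = 0 := by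
  rw [← LocalDP.mk_linElt]
  exact Ideal.Quotient.eq_zero_iff_mem.2 (Ideal.subset_span (Or.inr ⟨a, ha, rfl⟩))

/-- The algebra homomorphism given by images of the generators that satisfy the relations. -/
def LocalDP.lift (H S : Set α) {C : Type*} [CommRing C] [Algebra ℚ C] (w : H → C)
    (hm : ∀ T : Finset H, ¬ IsNested H (S ∪ Subtype.val '' (T : Set H)) → ∏ h ∈ T, w h = 0)
    (hl : ∀ a : α, IsAtom a → ∑ᶠ h ∈ {h : H | a ≤ (h : α)}, w h = 0) :
    LocalDP H S →ₐ[ℚ] C :=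
  Ideal.Quotient.liftₐ (localIdeal H S) (MvPolynomial.aeval w) (by
    intro f hf
    have hle : localIdeal H S ≤ RingHom.ker (MvPolynomial.aeval (R := ℚ) w) := by
      refine Ideal.span_le.2 ?_
      rintro f (⟨T, hT, rfl⟩ | ⟨a, ha, rfl⟩)
      · show MvPolynomial.aeval w _ = 0
        rw [map_prod]
        simpa using hm T hT
      · show MvPolynomial.aeval w _ = 0
        rw [linElt_eq_finsum_mem]
        refine ((MvPolynomial.aeval (R := ℚ) w).toRingHom.toAddMonoidHom.map_finsum_mem _
          (Set.toFinite _)).trans ?_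
        refine Eq.trans (finsum_mem_congr rfl fun h _ => ?_) (hl a ha)
        exact MvPolynomial.aeval_X w h
    exact hle hf)

@[simp]
theorem LocalDP.lift_var (H S : Set α) {C : Type*} [CommRing C] [Algebra ℚ C] (w : H → C)
    (hm : ∀ T : Finset H, ¬ IsNested H (S ∪ Subtype.val '' (T : Set H)) → ∏ h ∈ T, w h = 0)
    (hl : ∀ a : α, IsAtom a → ∑ᶠ h ∈ {h : H | a ≤ (h : α)}, w h = 0) (h : H) :
    LocalDP.lift H S w hm hl (LocalDP.var H S h) = w h :=
  MvPolynomial.aeval_X w h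

theorem LocalDP.algHom_ext {H S : Set α} {C : Type*} [CommRing C] [Algebra ℚ C]
    {f g : LocalDP H S →ₐ[ℚ] C} (h : ∀ i, f (LocalDP.var H S i) = g (LocalDP.var H S i)) :
    f = g :=
  Ideal.Quotient.algHom_ext _ (MvPolynomial.algHom_ext h)

theorem LocalDP.gradedMonoid_degree (H S : Set α) :
    SetLike.GradedMonoid (LocalDP.degree H S) where
  one_mem := ⟨1, MvPolynomial.isWeightedHomogeneous_one ℚ _,
    map_one (Ideal.Quotient.mkₐ ℚ (localIdeal H S))⟩
  mul_mem := by
    rintro i j _ _ ⟨a, ha, rfl⟩ ⟨b, hb, rfl⟩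
    exact ⟨a * b, MvPolynomial.IsWeightedHomogeneous.mul ha hb,
      map_mul (Ideal.Quotient.mkₐ ℚ (localIdeal H S)) _ _⟩

theorem LocalDP.var_mem_degree (H S : Set α) (h : H) : LocalDP.var H S h ∈ LocalDP.degree H S 2 :=
  ⟨MvPolynomial.X h, MvPolynomial.isWeightedHomogeneous_X ℚ _ h, rfl⟩

/-- A homogeneous polynomial is a combination of monomials of its weight, whose images are products
of elements of `𝒞 2`. Only multiplicativity of `𝒞` is used, not a direct sum decomposition. -/
theorem LocalDP.map_mem_degree {H S : Set α} {C : Type*} [CommRing C] [Algebra ℚ C]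
    {𝒞 : ℕ → Submodule ℚ C} (h𝒞 : SetLike.GradedMonoid 𝒞) (f : LocalDP H S →ₐ[ℚ] C)
    (hf : ∀ h, f (LocalDP.var H S h) ∈ 𝒞 2) {n : ℕ} {b : LocalDP H S}
    (hb : b ∈ LocalDP.degree H S n) : f b ∈ 𝒞 n := by
  obtain ⟨p, hp, rfl⟩ := hb
  have hp' : MvPolynomial.IsWeightedHomogeneous (fun _ : H => 2) p n := hp
  set F : MvPolynomial H ℚ →ₐ[ℚ] C := f.comp (Ideal.Quotient.mkₐ ℚ (localIdeal H S)) with hF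
  show F p ∈ 𝒞 n
  rw [p.as_sum, map_sum]
  refine Submodule.sum_mem _ fun d hd => ?_
  have hw := hp' (MvPolynomial.mem_support_iff.1 hd)
  rw [MvPolynomial.monomial_eq, map_mul, ← MvPolynomial.algebraMap_eq, AlgHom.commutes,
    ← Algebra.smul_def]
  refine Submodule.smul_mem _ _ ?_
  rw [Finsupp.prod, map_prod, ← hw, Finsupp.weight_apply, Finsupp.sum]
  refine SetLike.prod_mem_graded _ _ _ fun h _ => ?_
  rw [map_pow]
  exact SetLike.pow_mem_graded _ (hf h)

end Presentation

/-! ### Grading and universal property of finite tensor products. -/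

section TensorDegree

variable {ι : Type*} [Finite ι] {A : ι → Type*} [∀ i, CommRing (A i)] [∀ i, Algebra ℚ (A i)]

theorem gradedMonoid_tensorDegree {𝒜 : ∀ i, ℕ → Submodule ℚ (A i)}
    (h𝒜 : ∀ i, SetLike.GradedMonoid (𝒜 i)) : SetLike.GradedMonoid (tensorDegree 𝒜) where
  one_mem := Submodule.subset_span ⟨0, 1, by simp, fun i => (h𝒜 i).one_mem, rfl⟩
  mul_mem := by
    intro m n a b ha hb
    have : tensorDegree 𝒜 m * tensorDegree 𝒜 n ≤ tensorDegree 𝒜 (m + n) := by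
      rw [tensorDegree, tensorDegree, Submodule.span_mul_span, Submodule.span_le]
      rintro _ ⟨_, ⟨d, s, hd, hs, rfl⟩, _, ⟨e, t, he, ht, rfl⟩, rfl⟩
      refine Submodule.subset_span ⟨d + e, s * t, ?_, fun i => (h𝒜 i).mul_mem (hs i) (ht i),
        PiTensorProduct.tprod_mul_tprod _ _⟩
      rw [← hd, ← he]
      exact finsum_add_distrib (Set.toFinite _) (Set.toFinite _)
    exact this (Submodule.mul_mem_mul ha hb)

theorem singleAlgHom_mem_tensorDegree [DecidableEq ι] {𝒜 : ∀ i, ℕ → Submodule ℚ (A i)}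
    (h𝒜 : ∀ i, SetLike.GradedMonoid (𝒜 i)) {i : ι} {n : ℕ} {a : A i} (ha : a ∈ 𝒜 i n) :
    PiTensorProduct.singleAlgHom (R := ℚ) i a ∈ tensorDegree 𝒜 n := by
  refine Submodule.subset_span ⟨Pi.single i n, Pi.mulSingle i a, ?_, fun j => ?_, rfl⟩
  · rw [finsum_eq_single _ i fun j hj => by rw [Pi.single_eq_of_ne hj], Pi.single_eq_same]
  · by_cases hj : j = i
    · subst hj
      rwa [Pi.single_eq_same, Pi.mulSingle_eq_same]
    · rw [Pi.single_eq_of_ne hj, Pi.mulSingle_eq_of_ne hj]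
      exact (h𝒜 j).one_mem

/-- The product of algebra homomorphisms to a commutative algebra, on the tensor product. -/
theorem exists_tensor_lift [DecidableEq ι] {B : Type*} [CommRing B] [Algebra ℚ B]
    (ψ : ∀ i, A i →ₐ[ℚ] B) : ∃ Φ : (⨂[ℚ] i, A i) →ₐ[ℚ] B,
      (∀ a : ∀ i, A i, Φ (PiTensorProduct.tprod ℚ a) = ∏ᶠ i, ψ i (a i)) ∧
      ∀ i, Φ.comp (PiTensorProduct.singleAlgHom i) = ψ i := by
  have := Fintype.ofFinite ι
  let f : MultilinearMap ℚ A B :=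
    (MultilinearMap.mkPiAlgebra ℚ ι B).compLinearMap fun i => (ψ i).toLinearMap
  have hf : ∀ a : ∀ i, A i, f a = ∏ i, ψ i (a i) := fun a => by
    simp [f]
  let Φ := PiTensorProduct.liftAlgHom f (by rw [hf]; simp)
    (fun x y => by rw [hf, hf, hf]; simp [Finset.prod_mul_distrib])
  have hΦ : ∀ a : ∀ i, A i, Φ (PiTensorProduct.tprod ℚ a) = ∏ i, ψ i (a i) := fun a => by
    rw [← hf]
    exact PiTensorProduct.lift.tprod a
  refine ⟨Φ, fun a => by rw [hΦ, finprod_eq_prod_of_fintype], fun i => AlgHom.ext fun a => ?_⟩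
  show Φ (PiTensorProduct.tprod ℚ (Pi.mulSingle i a)) = _
  rw [hΦ, Finset.prod_eq_single i]
  · rw [Pi.mulSingle_eq_same]
  · intro j _ hj
    rw [Pi.mulSingle_eq_of_ne hj, map_one]
  · intro h
    exact absurd (Finset.mem_univ i) h

end TensorDegree

/-- A system of equations that determines the values at `p` by those at the elements above. -/
theorem exists_rec_sum {β C : Type*} [PartialOrder β] [Finite β] [AddCommGroup C] (v : β → C)
    (P : β → Prop) [DecidablePred P] :
    ∃ w : β → C, ∀ p, w p = v p - if P p then ∑ᶠ h ∈ {h | p < h}, w h else 0 := by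
  classical
  have hwf : WellFounded (fun a b : β => b < a) := Finite.wellFounded_of_trans_of_irrefl _
  let Fn : ∀ p : β, (∀ h, p < h → C) → C := fun p w =>
    v p - if P p then ∑ᶠ h, if hp : p < h then w h hp else 0 else 0
  refine ⟨hwf.fix Fn, fun p => ?_⟩
  rw [hwf.fix_eq]
  simp only [Fn]
  congr 2
  refine finsum_congr fun h => ?_
  by_cases hp : p < h
  · simp [hp]
  · simp [hp]

/-! ### The local decomposition -/

theorem IsNested.insert_top {α : Type u} [PartialOrder α] [OrderTop α] {H M : Set α}
    (hM : IsNested H M) (ht : ⊤ ∈ H) : IsNested H (insert ⊤ M) := by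
  refine ⟨Set.insert_subset ht hM.1, fun A hA hnt hanti => hM.2 A (fun a ha => ?_) hnt hanti⟩
  refine (hA ha).resolve_left ?_
  rintro rfl
  obtain ⟨b, hb, hne⟩ := hnt.exists_ne ⊤
  exact hanti hb ha hne le_top

/-- Different `p` may have the same local image, so a product of local generators is only a multiple
of the squarefree monomial on the image. -/
theorem prod_image_dvd {β γ C : Type*} [CommMonoid C] [DecidableEq γ] (s : Finset β) (e : β → γ)
    (w : γ → C) : ∏ c ∈ s.image e, w c ∣ ∏ b ∈ s, w (e b) := by
  rw [Finset.prod_comp w e]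
  refine Finset.prod_dvd_prod_of_dvd _ _ fun c hc => dvd_pow_self (w c) ?_
  obtain ⟨b, hb, rfl⟩ := Finset.mem_image.1 hc
  exact Finset.card_ne_zero_of_mem (a := b) (Finset.mem_filter.2 ⟨hb, rfl⟩)

section Decomposition

variable {L : Type u} [Lattice L] [BoundedOrder L] [Finite L] [IsAtomistic L]
  [IsUpperModularLattice L]

/-- The element `p ∨ z(g)` of the local building set. -/
def localElt {H N F : Set L} {p g : L} (hp : p ∈ closedStar H N) (hat : IsHat F p g) :
    localBuilding H N F g :=
  ⟨⟨p ⊔ base F g, le_sup_right, sup_le hat.1.2 (base_le F g)⟩, Or.inl ⟨p, hp, hat, rfl⟩⟩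

open Classical in
/-- The image `x_p`, or `c_g` if `p = g`, of the local generator belonging to `p`. -/
def starVar (H S : Set L) (g : L) (p : H) : LocalDP H S :=
  if (p : L) = g then ∑ᶠ h ∈ {h : H | g ≤ (h : L)}, LocalDP.var H S h else LocalDP.var H S p

open Classical in
/-- The image of a local generator. -/
def localVar (H S N F : Set L) (g : L) (q : localBuilding H N F g) : LocalDP H S :=
  if h : g ∈ nonAtoms H ∧ ∃ p : H, (p : L) ∈ closedStar H N ∧ IsHat F (p : L) g ∧
    (q.1 : L) = (p : L) ⊔ base F g then starVar H S g h.2.choose else 0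

namespace StarDatum

variable {G H N F : Set L} {x : L} (D : StarDatum G H N F x)
include D

/-- Members of `N` are already present, and ⊤ belongs to no antichain with two elements. -/
theorem isNested_of_diff {T : Set L} (hT : T ⊆ H) (h : IsNested H (N ∪ T \ insert ⊤ N)) :
    IsNested H (N ∪ T) := by
  by_cases ht : ⊤ ∈ T
  · refine (h.insert_top (hT ht)).mono ?_
    rintro s (hs | hs)
    · exact Or.inr (Or.inl hs)
    · by_cases hsN : s ∈ insert ⊤ N
      · rcases hsN with rfl | hsN
        · exact Or.inl rfl
        · exact Or.inr (Or.inl hsN)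
      · exact Or.inr (Or.inr ⟨hs, hsN⟩)
  · refine h.mono ?_
    rintro s (hs | hs)
    · exact Or.inl hs
    · by_cases hsN : s ∈ N
      · exact Or.inl hsN
      · refine Or.inr ⟨hs, ?_⟩
        rintro (rfl | h')
        · exact ht hs
        · exact hsN h'

theorem mem_star_of_isHat_notMem {p g : L} (hp : p ∈ H) (hat : IsHat F p g)
    (hgn : g ∉ nonAtoms H) : p ∈ closedStar H N := by
  have hpn : p ∉ nonAtoms H := fun h => hgn (D.filter h (D.F_mem_G hat.1.1) hat.1.2)
  by_cases hgt : g = ⊤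
  · subst hgt
    refine ⟨hp, isNested_of_join_lt_ne D.bot_notMem
      (Set.union_subset D.nested.1 (Set.singleton_subset_iff.2 hp)) fun k hk _ => ?_⟩
    exact hgn (D.filter hk D.top_mem le_top)
  · exact D.mem_star_of_mem ((D.atom_mem_iff p (D.atom_of_notMem hp hpn)).2
      (hat.1.2.trans (le_of_mem_factors (D.mem_factors_of_mem_F hat.1.1 hgn hgt))))

/-- Sums over the elements above `a`, arranged by the local interval of `a`. -/
theorem sum_ge_eq {C : Type*} [AddCommMonoid C] (w : H → C)
    (hw : ∀ h : H, (h : L) ∉ closedStar H N → w h = 0) {a g : L} (ha : a ∈ G)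
    (hat : IsHat F a g) :
    ∑ᶠ h ∈ {h : H | a ≤ (h : L)}, w h =
      ∑ᶠ k ∈ {k : H | g ≤ (k : L)}, w k +
        ∑ᶠ h ∈ {h : H | ((h : L) ∈ closedStar H N ∧ IsHat F (h : L) g ∧ a ≤ h) ∧ (h : L) ≠ g},
          w h := by
  have ha0 := D.ne_bot ha
  rw [← finsum_mem_union ?_ (Set.toFinite _) (Set.toFinite _)]
  · refine finsum_mem_inter_support_eq' _ _ _ fun h hh => ?_
    have hhV : (h : L) ∈ closedStar H N := by
      by_contra hc
      exact hh (hw h hc)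
    constructor
    · intro hah
      by_cases hgh : g ≤ (h : L)
      · exact Or.inl hgh
      -- Comparability leaves `h ≤ g`. As `a ≤ h` is not below z(g), neither is `h`, and so ĥ = g.
      · have hle := (D.comparable_of_star hhV hat.1.1 ha0 hah hat.1.2).resolve_right hgh
        refine Or.inr ⟨⟨hhV, ?_, hah⟩, fun e => hgh e.ge⟩
        exact D.isHat_of_not_le_base (D.ne_bot (D.mem_G hhV.1)) hat.1.1 hle
          fun hb => D.not_le_base_of_isHat ha hat (le_trans hah hb)
    · rintro (hgh | hh')
      · exact hat.1.2.trans hgh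
      · exact hh'.1.2.2
  · rw [Set.disjoint_left]
    intro h hgh hh
    exact hh.2 (le_antisymm hh.1.2.1.1.2 hgh)

theorem var_eq_zero {S : Set L} (hSN : ∀ T : Set L, IsNested H (S ∪ T) → IsNested H (N ∪ T))
    {h : H} (hh : (h : L) ∉ closedStar H N) : LocalDP.var H S h = 0 := by
  have := LocalDP.prod_var_eq_zero (H := H) (S := S) (T := {h}) (by
    intro hn
    refine hh ⟨h.2, ?_⟩
    have := hSN _ hn
    simpa using this)
  simpa using this

/-- Storing the whole sum c_g as the value at `g` gives c_a the shape of the local linear relation.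
This is why ψ_g sends x_g to c_g. -/
theorem sum_ge_star_eq {C : Type*} [AddCommMonoid C] (w v : H → C)
    (hw : ∀ h : H, (h : L) ∉ closedStar H N → w h = 0) {a g : L} (ha : a ∈ G)
    (hat : IsHat F a g) (hgn : g ∈ nonAtoms H)
    (hv : ∀ h : H, (h : L) ∈ closedStar H N → IsHat F (h : L) g → (h : L) ≠ g → v h = w h)
    (hvg : ∀ h : H, (h : L) = g → v h = ∑ᶠ k ∈ {k : H | g ≤ (k : L)}, w k) :
    ∑ᶠ h ∈ {h : H | a ≤ (h : L)}, w h =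
      ∑ᶠ h ∈ {h : H | (h : L) ∈ closedStar H N ∧ IsHat F (h : L) g ∧ a ≤ h}, v h := by
  rw [D.sum_ge_eq w hw ha hat]
  have hset : {h : H | (h : L) ∈ closedStar H N ∧ IsHat F (h : L) g ∧ a ≤ h} =
      insert ⟨g, hgn.1⟩
        {h : H | ((h : L) ∈ closedStar H N ∧ IsHat F (h : L) g ∧ a ≤ h) ∧ (h : L) ≠ g} := by
    ext h
    constructor
    · intro hh
      by_cases hg : (h : L) = g
      · exact Or.inl (Subtype.ext hg)
      · exact Or.inr ⟨hh, hg⟩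
    · rintro (rfl | hh)
      · exact ⟨D.mem_star_of_mem_F hat.1.1 hgn, D.isHat_self hat.1.1, hat.1.2⟩
      · exact hh.1
  rw [hset, finsum_mem_insert _ (fun h => h.2 rfl) (Set.toFinite _), hvg _ rfl]
  congr 1
  exact finsum_mem_congr rfl fun h hh => (hv h hh.1.1 hh.1.2.1 hh.2).symm

/-- Makes the image of a local generator independent of the representative. Only two atoms can share
a local image; for these the relations c_p = c_{p'} = 0 express both values as minus the same sum
over non-atoms. -/
theorem starVar_eq {S : Set L} (hSN : ∀ T : Set L, IsNested H (S ∪ T) → IsNested H (N ∪ T))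
    {p p' : H} {g : L} (hp : (p : L) ∈ closedStar H N) (hp' : (p' : L) ∈ closedStar H N)
    (hat : IsHat F (p : L) g) (hat' : IsHat F (p' : L) g) (hgn : g ∈ nonAtoms H)
    (he : (p : L) ⊔ base F g = (p' : L) ⊔ base F g) : starVar H S g p = starVar H S g p' := by
  by_cases hn : (p : L) ∈ nonAtoms H
  · rw [Subtype.ext (D.eq_of_sup_base_eq hp hp' hat hat' hn he)]
  by_cases hn' : (p' : L) ∈ nonAtoms H
  · rw [Subtype.ext (D.eq_of_sup_base_eq hp' hp hat' hat hn' he.symm)]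
  have ha := D.atom_of_notMem p.2 hn
  have ha' := D.atom_of_notMem p'.2 hn'
  have key : ∀ r : H, (r : L) ∈ closedStar H N → IsHat F (r : L) g → IsAtom (r : L) →
      0 = starVar H S g r + ∑ᶠ h ∈ {h : H | (h : L) ∈ closedStar H N ∧ IsHat F (h : L) g ∧
        (h : L) ∈ nonAtoms H ∧ (r : L) ≤ h}, starVar H S g h := by
    intro r hr hrat hra
    rw [← LocalDP.sum_var_eq_zero H S hra,
      D.sum_ge_star_eq (LocalDP.var H S) (starVar H S g) (fun h => D.var_eq_zero hSN)
        (D.mem_G r.2) hrat hgn (fun h _ _ hne => if_neg hne) (fun h hg => if_pos hg)]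
    have hset : {h : H | (h : L) ∈ closedStar H N ∧ IsHat F (h : L) g ∧ (r : L) ≤ h} =
        insert r {h : H | (h : L) ∈ closedStar H N ∧ IsHat F (h : L) g ∧
          (h : L) ∈ nonAtoms H ∧ (r : L) ≤ h} := by
      ext h
      constructor
      · intro hh
        by_cases hhn : (h : L) ∈ nonAtoms H
        · exact Or.inr ⟨hh.1, hh.2.1, hhn, hh.2.2⟩
        · have := ((D.atom_of_notMem h.2 hhn).le_iff.1 hh.2.2).resolve_left hra.1
          exact Or.inl (Subtype.ext this.symm)
      · rintro (rfl | hh)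
        · exact ⟨hr, hrat, le_rfl⟩
        · exact ⟨hh.1, hh.2.1, hh.2.2.2⟩
    rw [hset, finsum_mem_insert _ (fun h => h.2.2.1.2 hra) (Set.toFinite _)]
  have hset : {h : H | (h : L) ∈ closedStar H N ∧ IsHat F (h : L) g ∧
        (h : L) ∈ nonAtoms H ∧ (p : L) ≤ h} = {h : H | (h : L) ∈ closedStar H N ∧
        IsHat F (h : L) g ∧ (h : L) ∈ nonAtoms H ∧ (p' : L) ≤ h} := by
    ext h
    have h1 : ∀ r r' : H, IsHat F (r' : L) g → (r : L) ⊔ base F g = (r' : L) ⊔ base F g →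
        (h : L) ∈ closedStar H N → (h : L) ∈ nonAtoms H → (r : L) ≤ h → (r' : L) ≤ h :=
      fun r r' hr' hrr hV hhn hle => D.le_of_le_star_sup_base hV hhn (D.mem_G r'.2)
        (le_sup_left.trans (hrr.ge.trans (sup_le_sup_right hle _)))
        (D.not_le_base_of_isHat (D.mem_G r'.2) hr')
    exact ⟨fun hh => ⟨hh.1, hh.2.1, hh.2.2.1, h1 p p' hat' he hh.1 hh.2.2.1 hh.2.2.2⟩,
      fun hh => ⟨hh.1, hh.2.1, hh.2.2.1, h1 p' p hat he.symm hh.1 hh.2.2.1 hh.2.2.2⟩⟩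
  have e1 := key p hp hat ha
  rw [hset, key p' hp' hat' ha'] at e1
  exact (add_right_cancel e1).symm

/-- Sums over the local building set above an atom, as sums over the closed star. -/
theorem sum_local_eq {C : Type*} [AddCommMonoid C] {g : L} (hgn : g ∈ nonAtoms H)
    (w : localBuilding H N F g → C) (v : H → C)
    (hwv : ∀ (p : H) (q : localBuilding H N F g), (p : L) ∈ closedStar H N → IsHat F (p : L) g →
      (q.1 : L) = (p : L) ⊔ base F g → w q = v p)
    {q₀ : LocalInterval F g} (hq₀ : IsAtom q₀) {a : L} (ha : IsAtom a) (hat : IsHat F a g)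
    (haq : a ≤ (q₀ : L)) :
    ∑ᶠ q ∈ {q : localBuilding H N F g | q₀ ≤ q.1}, w q =
      ∑ᶠ h ∈ {h : H | (h : L) ∈ closedStar H N ∧ IsHat F (h : L) g ∧ a ≤ h}, v h := by
  classical
  have haG := D.mem_G (D.partialBuilding.atom_mem a ha)
  have hq₀' := D.sup_base_eq_of_covBy ((isAtom_localInterval_iff q₀).1 hq₀) haq
    (D.not_le_base_of_isHat haG hat)
  let e : H → localBuilding H N F g := fun h =>
    if hc : (h : L) ∈ closedStar H N ∧ IsHat F (h : L) g then localElt hc.1 hc.2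
    else ⟨q₀, Or.inr hq₀⟩
  have he : ∀ h : H, (h : L) ∈ closedStar H N → IsHat F (h : L) g →
      ((e h).1 : L) = (h : L) ⊔ base F g := fun h h1 h2 => by
    simp only [e, dif_pos (And.intro h1 h2)]
    rfl
  symm
  refine finsum_mem_eq_of_bijOn e ⟨?_, ?_, ?_⟩ fun h hh => ?_
  · intro h hh
    show (q₀ : L) ≤ ((e h).1 : L)
    rw [he h hh.1 hh.2.1, ← hq₀']
    exact sup_le_sup_right hh.2.2 _
  · intro h hh h' hh' hee
    have := congrArg (fun q : localBuilding H N F g => (q.1 : L)) hee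
    simp only [he h hh.1 hh.2.1, he h' hh'.1 hh'.2.1] at this
    exact Subtype.ext (D.eq_of_ge_atom ha hh.1 hh'.1 hh.2.1 hh'.2.1 hh.2.2 hh'.2.2 this)
  · intro q hq
    obtain ⟨p, hp, hpat, hap, hqp⟩ := D.exists_star_eq_ge ha hat hgn q.2
      (haq.trans (show (q₀ : L) ≤ (q.1 : L) from hq))
    refine ⟨⟨p, hp.1⟩, ⟨hp, hpat, hap⟩, Subtype.ext (Subtype.ext ?_)⟩
    rw [he _ hp hpat, hqp]
  · exact (hwv h (e h) hh.1 hh.2.1 (he h hh.1 hh.2.1)).symm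

theorem localVar_eq {S : Set L} (hSN : ∀ T : Set L, IsNested H (S ∪ T) → IsNested H (N ∪ T))
    {g : L} (hgn : g ∈ nonAtoms H) (p : H) (q : localBuilding H N F g)
    (hp : (p : L) ∈ closedStar H N) (hat : IsHat F (p : L) g) (hq : (q.1 : L) = (p : L) ⊔ base F g) :
    localVar H S N F g q = starVar H S g p := by
  have h : g ∈ nonAtoms H ∧ ∃ p : H, (p : L) ∈ closedStar H N ∧ IsHat F (p : L) g ∧
    (q.1 : L) = (p : L) ⊔ base F g := ⟨hgn, p, hp, hat, hq⟩
  have hs := h.2.choose_spec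
  rw [localVar, dif_pos h]
  exact D.starVar_eq hSN hs.1 hp hs.2.1 hat hgn (hs.2.2.symm.trans hq)

theorem localVar_eq_zero {S : Set L} {g : L} (hgn : g ∉ nonAtoms H)
    (q : localBuilding H N F g) : localVar H S N F g q = 0 := dif_neg fun h => hgn h.1

/-- Representatives of a non-nested local set stay non-nested over `N` after those in `N ∪ {⊤}` are
discarded. `g` is thereby discarded too, so the remaining factors are true generators and their
product is a monomial relation. -/
theorem prod_localVar_eq_zero {S : Set L}
    (hSN : ∀ T : Set L, IsNested H (S ∪ T) → IsNested H (N ∪ T)) {g : L} (hg : g ∈ F)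
    (T : Finset (localBuilding H N F g))
    (hT : ¬ IsNested (localBuilding H N F g) (∅ ∪ Subtype.val '' (T : Set (localBuilding H N F g)))) :
    ∏ q ∈ T, localVar H S N F g q = 0 := by
  classical
  rw [Set.empty_union] at hT
  by_cases hgn : g ∈ nonAtoms H
  swap
  · have hne : T.Nonempty := by
      by_contra hc
      rw [Finset.not_nonempty_iff_eq_empty] at hc
      subst hc
      refine hT ⟨by simp, fun A hA hnt => ?_⟩
      obtain ⟨a, ha⟩ := hnt.nonempty
      simpa using hA ha
    obtain ⟨q, hq⟩ := hne
    exact Finset.prod_eq_zero hq (D.localVar_eq_zero hgn q)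
  choose r hr hrat hrq using fun q : localBuilding H N F g => D.exists_star_eq hg hgn q.2
  let r' : localBuilding H N F g → H := fun q => ⟨r q, (hr q).1⟩
  have hinj : Function.Injective r' := by
    intro q q' h
    have h' : r q = r q' := congrArg Subtype.val h
    exact Subtype.ext (Subtype.ext (by rw [hrq, hrq, h']))
  have hP : ¬ IsNested H (N ∪ r '' (T : Set (localBuilding H N F g))) := by
    intro hn
    refine hT ((D.isNested_local (F := F) (g := g) (P := r '' (T : Set (localBuilding H N F g))) ?_ ?_ hn).mono ?_)
    · rintro _ ⟨q, -, rfl⟩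
      exact hr q
    · rintro _ ⟨q, -, rfl⟩
      exact hrat q
    · rintro _ ⟨q, hq, rfl⟩
      exact ⟨r q, ⟨q, hq, rfl⟩, hrq q⟩
  have hP' : ¬ IsNested H (N ∪ (r '' (T : Set (localBuilding H N F g))) \ insert ⊤ N) := fun hn =>
    hP (D.isNested_of_diff (by rintro _ ⟨q, -, rfl⟩; exact (hr q).1) hn)
  have hz : ∏ h ∈ (T.image r').filter (fun h : H => (h : L) ∉ insert ⊤ N), LocalDP.var H S h = 0 := by
    refine LocalDP.prod_var_eq_zero fun hn => hP' ((hSN _ hn).mono ?_)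
    refine Set.union_subset_union_right _ ?_
    rintro _ ⟨⟨q, hq, rfl⟩, hqn⟩
    exact ⟨r' q, by
      rw [Finset.mem_coe, Finset.mem_filter]
      exact ⟨Finset.mem_image_of_mem r' hq, hqn⟩, rfl⟩
  have h1 : ∏ q ∈ T, localVar H S N F g q = ∏ h ∈ T.image r', starVar H S g h := by
    rw [Finset.prod_image hinj.injOn]
    exact Finset.prod_congr rfl fun q _ =>
      D.localVar_eq hSN hgn (r' q) q (hr q) (hrat q) (hrq q)
  have h2 : ∏ h ∈ (T.image r').filter (fun h : H => (h : L) ∉ insert ⊤ N), starVar H S g h = 0 := by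
    rw [← hz]
    refine Finset.prod_congr rfl fun h hh => if_neg ?_
    rintro hhg
    exact (Finset.mem_filter.1 hh).2 (hhg ▸ D.mem_insert_of_mem_F hg hgn)
  rw [h1]
  exact zero_dvd_iff.1 (h2 ▸ Finset.prod_dvd_prod_of_subset _ _ _ (Finset.filter_subset _ _))

theorem sum_localVar_eq_zero {S : Set L}
    (hSN : ∀ T : Set L, IsNested H (S ∪ T) → IsNested H (N ∪ T)) {g : L} (hg : g ∈ F)
    (q₀ : LocalInterval F g) (hq₀ : IsAtom q₀) :
    ∑ᶠ q ∈ {q : localBuilding H N F g | q₀ ≤ q.1}, localVar H S N F g q = 0 := by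
  by_cases hgn : g ∈ nonAtoms H
  · obtain ⟨a, ha, haq, hat⟩ := D.exists_atom_of_lt
      ((isAtom_localInterval_iff q₀).1 hq₀).1.ne' hg
    rw [D.sum_local_eq hgn _ (starVar H S g) (D.localVar_eq hSN hgn) hq₀ ha hat haq,
      ← D.sum_ge_star_eq (LocalDP.var H S) (starVar H S g) (fun h => D.var_eq_zero hSN)
        (D.mem_G (D.partialBuilding.atom_mem a ha)) hat hgn
        (fun h _ _ hne => if_neg hne) (fun h hg => if_pos hg)]
    exact LocalDP.sum_var_eq_zero H S ha
  · exact (finsum_mem_congr rfl fun q _ => D.localVar_eq_zero hgn q).trans (finsum_mem_zero _)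

/-- The algebra homomorphism `ψ_g`. -/
def psi {S : Set L} (hSN : ∀ T : Set L, IsNested H (S ∪ T) → IsNested H (N ∪ T)) {g : L}
    (hg : g ∈ F) : DP (localBuilding H N F g) →ₐ[ℚ] LocalDP H S :=
  LocalDP.lift _ _ (localVar H S N F g) (D.prod_localVar_eq_zero hSN hg)
    (D.sum_localVar_eq_zero hSN hg)

theorem psi_var {S : Set L} (hSN : ∀ T : Set L, IsNested H (S ∪ T) → IsNested H (N ∪ T)) {g : L}
    (hg : g ∈ F) (q : localBuilding H N F g) :
    D.psi hSN hg (LocalDP.var _ _ q) = localVar H S N F g q := LocalDP.lift_var _ _ _ _ _ q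

theorem starVar_mem_degree (S : Set L) (g : L) (p : H) :
    starVar H S g p ∈ LocalDP.degree H S 2 := by
  unfold starVar
  split_ifs
  · exact finsum_mem_induction (· ∈ LocalDP.degree H S 2) (Submodule.zero_mem _)
      (fun _ _ => Submodule.add_mem _) fun h _ => LocalDP.var_mem_degree H S h
  · exact LocalDP.var_mem_degree H S p

theorem psi_mem_degree {S : Set L}
    (hSN : ∀ T : Set L, IsNested H (S ∪ T) → IsNested H (N ∪ T)) {g : L} (hg : g ∈ F) {n : ℕ}
    {b : DP (localBuilding H N F g)} (hb : b ∈ LocalDP.degree (localBuilding H N F g) ∅ n) :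
    D.psi hSN hg b ∈ LocalDP.degree H S n := by
  refine LocalDP.map_mem_degree (LocalDP.gradedMonoid_degree H S) _ (fun q => ?_) hb
  rw [D.psi_var, localVar]
  split_ifs
  · exact D.starVar_mem_degree S g _
  · exact Submodule.zero_mem _

end StarDatum

end Decomposition

/-! ### The inverse of the product of the ψ_g. -/

section Inverse

variable {L : Type u} [Lattice L] [BoundedOrder L] [Finite L] [IsAtomistic L]
  [IsUpperModularLattice L]

namespace StarDatum

variable {G H N F : Set L} {x : L} (D : StarDatum G H N F x)
include D

/-- When all members of the local building set are atoms, the linear relation at `q` has the single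
term x_q. -/
theorem var_local_eq_zero {g : L} (hgn : g ∉ nonAtoms H) (q : localBuilding H N F g) :
    LocalDP.var (localBuilding H N F g) ∅ q = 0 := by
  have hq := D.isAtom_of_notMem_nonAtoms hgn q.2
  have h := LocalDP.sum_var_eq_zero (localBuilding H N F g) ∅ hq
  have hset : {q' : localBuilding H N F g | q.1 ≤ q'.1} = {q} := by
    ext q'
    constructor
    · intro hle
      have := ((D.isAtom_of_notMem_nonAtoms hgn q'.2).le_iff.1 hle).resolve_left hq.1
      exact Subtype.ext this.symm
    · rintro rfl
      exact le_rfl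
  rwa [hset, finsum_mem_singleton] at h

section Values

variable {C : Type*} [CommRing C] [Algebra ℚ C] {J : Set L}
  (ι : ∀ g : J, DP (localBuilding H N F (g : L)) →ₐ[ℚ] C)

/-- The images of the generators under the inverse isomorphism: `v p` is the class of
`x_{p ∨ z(g)}` for `g = p̂`, and `w p` is the image of `x_p`. -/
theorem exists_values (hJ : F ∩ nonAtoms H ⊆ J) : ∃ v w : H → C,
    (∀ (p : H) (g : L) (hg : g ∈ F ∩ nonAtoms H) (hp : (p : L) ∈ closedStar H N)
      (hat : IsHat F (p : L) g), v p = ι ⟨g, hJ hg⟩ (LocalDP.var _ _ (localElt hp hat))) ∧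
    (∀ p : H, (p : L) ∉ closedStar H N → v p = 0) ∧
    (∀ (p : H) (g : L), IsHat F (p : L) g → g ∉ nonAtoms H → v p = 0) ∧
    (∀ p : H, (p : L) ∈ F → (p : L) ∈ nonAtoms H →
      w p = v p - ∑ᶠ h ∈ {h | p < h}, w h) ∧
    (∀ (p : H) (g : L), IsHat F (p : L) g → g ∉ nonAtoms H →
      w p = v p - ∑ᶠ h ∈ {h | p < h}, w h) ∧
    (∀ (p : H) (g : L), IsHat F (p : L) g → g ∈ nonAtoms H → (p : L) ≠ g → w p = v p) := by
  classical
  let v : H → C := fun p =>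
    if h : ∃ g, ∃ _ : g ∈ F ∩ nonAtoms H, (p : L) ∈ closedStar H N ∧ IsHat F (p : L) g then
      ι ⟨h.choose, hJ h.choose_spec.choose⟩ (LocalDP.var _ _
        (localElt h.choose_spec.choose_spec.1 h.choose_spec.choose_spec.2)) else 0
  -- `P` marks the `p` at which the sum of `w` over all `h ≥ p` is prescribed to be `v p`. Elsewhere
  -- `w p` itself is `v p`.
  let P : H → Prop := fun p => ((p : L) ∈ F ∧ (p : L) ∈ nonAtoms H) ∨
    ∃ g, IsHat F (p : L) g ∧ g ∉ nonAtoms H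
  obtain ⟨w, hw⟩ := exists_rec_sum v P
  refine ⟨v, w, ?_, ?_, ?_, ?_, ?_, ?_⟩
  · intro p g hg hp hat
    have h : ∃ g, ∃ _ : g ∈ F ∩ nonAtoms H, (p : L) ∈ closedStar H N ∧ IsHat F (p : L) g :=
      ⟨g, hg, hp, hat⟩
    simp only [v, dif_pos h]
    have hgen : ∀ (g' : L) (hg' : g' ∈ F ∩ nonAtoms H) (hat' : IsHat F (p : L) g'), g' = g →
        ι ⟨g', hJ hg'⟩ (LocalDP.var _ _ (localElt hp hat')) =
          ι ⟨g, hJ hg⟩ (LocalDP.var _ _ (localElt hp hat)) := by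
      rintro g' hg' hat' rfl
      rfl
    exact hgen _ h.choose_spec.choose h.choose_spec.choose_spec.2
      (h.choose_spec.choose_spec.2.unique hat)
  · intro p hp
    exact dif_neg fun ⟨g, hg, h⟩ => hp h.1
  · intro p g hat hgn
    exact dif_neg fun ⟨g', hg', h⟩ => hgn (h.2.unique hat ▸ hg'.2)
  · intro p hpF hpn
    rw [hw p, if_pos (Or.inl ⟨hpF, hpn⟩)]
  · intro p g hat hgn
    rw [hw p, if_pos (Or.inr ⟨g, hat, hgn⟩)]
  · intro p g hat hgn hne
    rw [hw p, if_neg, sub_zero]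
    rintro (⟨hpF, -⟩ | ⟨g', hat', hgn'⟩)
    · exact hne (hat.unique (D.isHat_self hpF)).symm
    · exact hgn' (hat.unique hat' ▸ hgn)

variable {S : Set L}

/-- The inverse isomorphism, from a family of homomorphisms on the local algebras. -/
theorem exists_inverse (hJ : F ∩ nonAtoms H ⊆ J)
    (hSN : ∀ T : Set L, IsNested H (S ∪ T) → IsNested H (N ∪ T))
    (hS : S ⊆ N) (hJF : J ⊆ F) :
    ∃ Θ : LocalDP H S →ₐ[ℚ] C,
      (∀ g : J, Θ.comp (D.psi hSN (hJF g.2)) = ι g) ∧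
      (∀ Φ : C →ₐ[ℚ] LocalDP H S, (∀ g : J, Φ.comp (ι g) = D.psi hSN (hJF g.2)) →
        Φ.comp Θ = AlgHom.id ℚ _) ∧
      ∀ 𝒞 : Submodule ℚ C, (∀ g : J, ∀ q, ι g (LocalDP.var _ _ q) ∈ 𝒞) →
        ∀ p, Θ (LocalDP.var H S p) ∈ 𝒞 := by
  classical
  obtain ⟨v, w, hv, hvV, hvn, hwF, hwn, hw⟩ := D.exists_values ι hJ
  have hat : ∀ p : H, ∃ g, IsHat F (p : L) g := fun p => D.exists_isHat (D.ne_bot (D.mem_G p.2))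
  have hwV : ∀ p : H, (p : L) ∉ closedStar H N → w p = 0 := by
    intro p hp
    obtain ⟨g, hg⟩ := hat p
    by_cases hgn : g ∈ nonAtoms H
    · rw [hw p g hg hgn, hvV p hp]
      rintro rfl
      exact hp (D.mem_star_of_mem_F hg.1.1 hgn)
    · exact absurd (D.mem_star_of_isHat_notMem p.2 hg hgn) hp
  have hsum : ∀ p : H, w p = v p - ∑ᶠ h ∈ {h | p < h}, w h →
      ∑ᶠ h ∈ {h : H | (p : L) ≤ (h : L)}, w h = v p := by
    intro p hp
    have hset : {h : H | (p : L) ≤ (h : L)} = insert p {h | p < h} := by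
      ext h
      exact ⟨fun h' => (eq_or_lt_of_le (show p ≤ h from h')).imp Eq.symm id,
        fun h' => h'.elim (fun e => (congrArg Subtype.val e).ge) fun h'' => le_of_lt h''⟩
    rw [hset, finsum_mem_insert _ (show p ∉ {h | p < h} from lt_irrefl p) (Set.toFinite _), hp, sub_add_cancel]
  have hlin : ∀ a : L, IsAtom a → ∑ᶠ h ∈ {h : H | a ≤ (h : L)}, w h = 0 := by
    intro a ha
    have haH := D.partialBuilding.atom_mem a ha
    obtain ⟨g, hg⟩ := hat ⟨a, haH⟩
    by_cases hgn : g ∈ nonAtoms H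
    · rw [D.sum_ge_star_eq w v hwV (D.mem_G haH) hg hgn
        (fun h _ hh hne => (hw h g hh hgn hne).symm)
        (fun h hh => by
          subst hh
          exact (hsum h (hwF h hg.1.1 hgn)).symm)]
      let q₀ : LocalInterval F g := ⟨a ⊔ base F g, le_sup_right, sup_le hg.1.2 (base_le F g)⟩
      have hq₀ : IsAtom q₀ := D.isAtom_of_eq_sup ha hg rfl
      rw [← D.sum_local_eq hgn (fun q => ι ⟨g, hJ ⟨hg.1.1, hgn⟩⟩ (LocalDP.var _ _ q)) v
        (fun p q hp hpat hq => ?_) hq₀ ha hg le_sup_left]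
      · refine Eq.trans ((ι ⟨g, hJ ⟨hg.1.1, hgn⟩⟩).toRingHom.toAddMonoidHom.map_finsum_mem _
          (Set.toFinite _)).symm ?_
        refine (congrArg (ι ⟨g, hJ ⟨hg.1.1, hgn⟩⟩) (LocalDP.sum_var_eq_zero _ ∅ hq₀)).trans ?_
        exact map_zero _
      · rw [hv p g ⟨hg.1.1, hgn⟩ hp hpat]
        congr 2
        exact Subtype.ext (Subtype.ext hq)
    · have := hsum ⟨a, haH⟩ (hwn ⟨a, haH⟩ g hg hgn)
      rw [hvn ⟨a, haH⟩ g hg hgn] at this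
      exact this
  have hmon : ∀ T : Finset H, ¬ IsNested H (S ∪ Subtype.val '' (T : Set H)) →
      ∏ h ∈ T, w h = 0 := by
    intro T hT
    have hT1 : ¬ IsNested H (N ∪ (Subtype.val '' (T : Set H)) \ insert ⊤ N) := by
      intro hn
      refine hT ((D.isNested_of_diff ?_ hn).mono (Set.union_subset_union_left _ hS))
      rintro _ ⟨h, -, rfl⟩
      exact h.2
    by_cases hV : ∃ p ∈ T, (p : L) ∉ closedStar H N
    · obtain ⟨p, hp, hpV⟩ := hV
      exact Finset.prod_eq_zero hp (hwV p hpV)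
    push Not at hV
    have hex : ∃ g ∈ F, ∃ _ : g ∈ nonAtoms H, ¬ IsNested (localBuilding H N F g)
        {q : LocalInterval F g | ∃ p ∈ (Subtype.val '' (T : Set H)) \ insert ⊤ N,
          IsHat F p g ∧ (q : L) = p ⊔ base F g} := by
      by_contra hc
      push Not at hc
      refine hT1 (D.isNested_of_local ?_ hc)
      rintro _ ⟨⟨h, hh, rfl⟩, -⟩
      exact hV h hh
    obtain ⟨g, hgF, hgn, hloc⟩ := hex
    -- Once `N ∪ {⊤}` is removed, `g` does not occur, so `w` and `v` agree on the elements with hat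
    -- `g` and the local monomial relation applies.
    let T₁ := T.filter fun h : H => (h : L) ∉ insert ⊤ N
    let T₂ : Finset {p : H // (p : L) ∈ closedStar H N ∧ IsHat F (p : L) g} := T₁.subtype _
    let e : {p : H // (p : L) ∈ closedStar H N ∧ IsHat F (p : L) g} → localBuilding H N F g :=
      fun p => localElt p.2.1 p.2.2
    have hz : ∏ q ∈ T₂.image e, LocalDP.var (localBuilding H N F g) ∅ q = 0 := by
      refine LocalDP.prod_var_eq_zero fun hn => hloc (hn.mono ?_)
      rintro q ⟨p, ⟨⟨h, hh, rfl⟩, hpn⟩, hpat, hq⟩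
      refine Or.inr ⟨e ⟨h, hV h hh, hpat⟩, ?_, Subtype.ext hq.symm⟩
      refine Finset.mem_coe.2 (Finset.mem_image_of_mem e ?_)
      rw [Finset.mem_subtype]
      exact Finset.mem_filter.2 ⟨hh, hpn⟩
    have hz' : ∏ p ∈ T₂, LocalDP.var (localBuilding H N F g) ∅ (e p) = 0 :=
      zero_dvd_iff.1 (hz ▸ prod_image_dvd T₂ e _)
    have hz'' : ∏ p ∈ T₂, w p.1 = 0 := by
      rw [← map_zero (ι ⟨g, hJ ⟨hgF, hgn⟩⟩), ← hz', map_prod]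
      refine Finset.prod_congr rfl fun p hp => ?_
      rw [hw p.1 g p.2.2 hgn, hv p.1 g ⟨hgF, hgn⟩ p.2.1 p.2.2]
      intro hpg
      have := (Finset.mem_filter.1 (Finset.mem_subtype.1 hp)).2
      rw [hpg] at this
      exact this (D.mem_insert_of_mem_F hgF hgn)
    rw [Finset.prod_subtype_eq_prod_filter (s := T₁) w] at hz''
    refine zero_dvd_iff.1 (hz'' ▸ Finset.prod_dvd_prod_of_subset _ _ _ ?_)
    exact (Finset.filter_subset _ _).trans (Finset.filter_subset _ _)
  refine ⟨LocalDP.lift H S w hmon hlin, fun g => LocalDP.algHom_ext fun q => ?_,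
    fun Φ hΦ => LocalDP.algHom_ext fun p => ?_, fun 𝒞 h𝒞 p => ?_⟩
  · rw [AlgHom.comp_apply, D.psi_var]
    by_cases hgn : (g : L) ∈ nonAtoms H
    · obtain ⟨p, hp, hpat, hq⟩ := D.exists_star_eq (hJF g.2) hgn q.2
      have hvp := hv ⟨p, hp.1⟩ g ⟨hJF g.2, hgn⟩ hp hpat
      have hqe : q = localElt hp hpat := Subtype.ext (Subtype.ext hq)
      rw [D.localVar_eq hSN hgn ⟨p, hp.1⟩ q hp hpat hq, hqe]
      refine Eq.trans ?_ hvp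
      unfold starVar
      split_ifs with hpg
      · have hpg' : p = (g : L) := hpg
        refine Eq.trans ((LocalDP.lift H S w hmon hlin).toRingHom.toAddMonoidHom.map_finsum_mem _
          (Set.toFinite _)) ?_
        refine Eq.trans (finsum_mem_congr (by rw [← hpg']) fun h _ =>
          LocalDP.lift_var H S w hmon hlin h) (hsum ⟨p, hp.1⟩ (hwF ⟨p, hp.1⟩ ?_ ?_))
        · show p ∈ F
          rw [hpg']
          exact hJF g.2
        · show p ∈ nonAtoms H
          rw [hpg']
          exact hgn
      · rw [LocalDP.lift_var]
        exact hw ⟨p, hp.1⟩ g hpat hgn hpg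
    · rw [D.localVar_eq_zero hgn, map_zero, D.var_local_eq_zero hgn, map_zero]
  · rw [AlgHom.comp_apply, LocalDP.lift_var, AlgHom.id_apply]
    have hΦι : ∀ (g : J) q, Φ (ι g (LocalDP.var _ _ q)) = localVar H S N F g q := fun g q => by
      rw [← D.psi_var hSN (hJF g.2), ← hΦ g, AlgHom.comp_apply]
    have hΦv : ∀ (p : H) (g : L), g ∈ nonAtoms H → (p : L) ∈ closedStar H N →
        IsHat F (p : L) g → Φ (v p) = starVar H S g p := fun p g hgn hp hpat => by
      rw [hv p g ⟨hpat.1.1, hgn⟩ hp hpat, hΦι]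
      exact D.localVar_eq hSN hgn p _ hp hpat rfl
    have hsum' : ∀ p : H, ∑ᶠ h ∈ {h : H | (p : L) ≤ (h : L)}, LocalDP.var H S h =
        LocalDP.var H S p + ∑ᶠ h ∈ {h | p < h}, LocalDP.var H S h := by
      intro p
      have hset : {h : H | (p : L) ≤ (h : L)} = insert p {h | p < h} := by
        ext h
        exact ⟨fun h' => (eq_or_lt_of_le (show p ≤ h from h')).imp Eq.symm id,
          fun h' => h'.elim (fun e => (congrArg Subtype.val e).ge) fun h'' => le_of_lt h''⟩
      rw [hset, finsum_mem_insert _ (show p ∉ {h | p < h} from lt_irrefl p) (Set.toFinite _)]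
    -- Descending induction: once x_h is recovered for all h > p, the equation defining `w p`
    -- recovers x_p.
    have hwf : WellFounded (fun a b : H => b < a) := Finite.wellFounded_of_trans_of_irrefl _
    induction p using hwf.induction with
    | _ p ih =>
    have hrec : w p = v p - ∑ᶠ h ∈ {h | p < h}, w h →
        Φ (w p) = Φ (v p) - ∑ᶠ h ∈ {h | p < h}, LocalDP.var H S h := by
      intro h
      rw [h, map_sub]
      congr 1
      refine Eq.trans (Φ.toRingHom.toAddMonoidHom.map_finsum_mem _ (Set.toFinite _)) ?_
      exact finsum_mem_congr rfl fun h hh => ih h hh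
    obtain ⟨g, hg⟩ := hat p
    by_cases hgn : g ∈ nonAtoms H
    · by_cases hpg : (p : L) = g
      · subst hpg
        rw [hrec (hwF p hg.1.1 hgn), hΦv p p hgn (D.mem_star_of_mem_F hg.1.1 hgn) hg, starVar,
          if_pos rfl, hsum', add_sub_cancel_right]
      · by_cases hp : (p : L) ∈ closedStar H N
        · rw [hw p g hg hgn hpg, hΦv p g hgn hp hg, starVar, if_neg hpg]
        · rw [hwV p hp, map_zero, D.var_eq_zero hSN hp]
    · rw [hrec (hwn p g hg hgn), hvn p g hg hgn, map_zero, zero_sub]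
      -- Here `p` is an atom, and c_p = 0 gives x_p as minus the sum of the x_h with h > p.
      have hpa := D.atom_of_notMem p.2 fun h => hgn (D.filter h (D.F_mem_G hg.1.1) hg.1.2)
      have := LocalDP.sum_var_eq_zero H S hpa
      rw [hsum'] at this
      exact (eq_neg_of_add_eq_zero_left this).symm
  · rw [LocalDP.lift_var]
    have hv𝒞 : ∀ p, v p ∈ 𝒞 := by
      intro p
      obtain ⟨g, hg⟩ := hat p
      by_cases hgn : g ∈ nonAtoms H
      · by_cases hp : (p : L) ∈ closedStar H N
        · rw [hv p g ⟨hg.1.1, hgn⟩ hp hg]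
          exact h𝒞 _ _
        · rw [hvV p hp]
          exact 𝒞.zero_mem
      · rw [hvn p g hg hgn]
        exact 𝒞.zero_mem
    have hwf : WellFounded (fun a b : H => b < a) := Finite.wellFounded_of_trans_of_irrefl _
    induction p using hwf.induction with
    | _ p ih =>
    have hrec : w p = v p - ∑ᶠ h ∈ {h | p < h}, w h → w p ∈ 𝒞 := by
      intro h
      rw [h]
      exact 𝒞.sub_mem (hv𝒞 p) (finsum_mem_induction (· ∈ 𝒞) 𝒞.zero_mem
        (fun _ _ => 𝒞.add_mem) fun h hh => ih h hh)
    obtain ⟨g, hg⟩ := hat p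
    by_cases hgn : g ∈ nonAtoms H
    · by_cases hpg : (p : L) = g
      · exact hrec (hwF p (hpg ▸ hg.1.1) (hpg ▸ hgn))
      · rw [hw p g hg hgn hpg]
        exact hv𝒞 p
    · exact hrec (hwn p g hg hgn)

end Values

/-- The local tensor decomposition, over any set of indices between `F ∩ H°` and `F`. -/
theorem exists_tensor_equiv {S : Set L}
    (hSN : ∀ T : Set L, IsNested H (S ∪ T) → IsNested H (N ∪ T)) (hS : S ⊆ N) {J : Set L}
    (hJ : F ∩ nonAtoms H ⊆ J) (hJF : J ⊆ F) :
    ∃ e : (⨂[ℚ] g : J, DP (localBuilding H N F (g : L))) ≃ₐ[ℚ] LocalDP H S,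
      (∀ n, (tensorDegree
        (fun g : J => LocalDP.degree (localBuilding H N F (g : L)) ∅) n).map e.toLinearMap =
          LocalDP.degree H S n) ∧
      ∀ a : ∀ g : J, DP (localBuilding H N F (g : L)),
        e (PiTensorProduct.tprod ℚ a) = ∏ᶠ g, D.psi hSN (hJF g.2) (a g) := by
  classical
  have h𝒜 : ∀ g : J, SetLike.GradedMonoid (LocalDP.degree (localBuilding H N F (g : L)) ∅) :=
    fun g => LocalDP.gradedMonoid_degree _ _
  obtain ⟨Φ, hΦ, hΦι⟩ := exists_tensor_lift
    (A := fun g : J => DP (localBuilding H N F (g : L))) (fun g => D.psi hSN (hJF g.2))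
  obtain ⟨Θ, hΘ, hΦΘ, hdeg⟩ := D.exists_inverse
    (C := ⨂[ℚ] g : J, DP (localBuilding H N F (g : L)))
    (fun g : J => PiTensorProduct.singleAlgHom (R := ℚ)
      (A := fun g : J => DP (localBuilding H N F (g : L))) g) hJ hSN hS hJF
  have h1 : Φ.comp Θ = AlgHom.id ℚ _ := hΦΘ Φ hΦι
  have h2 : Θ.comp Φ = AlgHom.id ℚ _ := by
    refine PiTensorProduct.algHom_ext fun g => ?_
    rw [AlgHom.comp_assoc, hΦι, hΘ, AlgHom.id_comp]
  -- The degree parts correspond because both `Φ` and its inverse `Θ` preserve degrees.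
  refine ⟨AlgEquiv.ofAlgHom Φ Θ h1 h2, fun n => le_antisymm ?_ ?_, hΦ⟩
  · rw [Submodule.map_le_iff_le_comap, tensorDegree, Submodule.span_le]
    rintro _ ⟨d, a, hd, ha, rfl⟩
    show Φ (PiTensorProduct.tprod ℚ a) ∈ LocalDP.degree H S n
    have := Fintype.ofFinite J
    have := LocalDP.gradedMonoid_degree H S
    rw [hΦ, finprod_eq_prod_of_fintype, ← hd, finsum_eq_sum_of_fintype]
    exact SetLike.prod_mem_graded _ _ _ fun g _ => D.psi_mem_degree hSN (hJF g.2) (ha g)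
  · intro b hb
    refine ⟨Θ b, ?_, DFunLike.congr_fun h1 b⟩
    refine LocalDP.map_mem_degree (gradedMonoid_tensorDegree h𝒜) Θ (fun p => ?_) hb
    exact hdeg _ (fun g q => singleAlgHom_mem_tensorDegree h𝒜 (LocalDP.var_mem_degree _ _ q)) p

end StarDatum

end Inverse

end LerayModel

end

theorem mainTheorem5 {L : Type*} [Lattice L] [BoundedOrder L] [Finite L] [IsAtomistic L]
    [IsUpperModularLattice L] (G H : Set L)
    (hG : IsBuildingSet G) (hG_top : ⊤ ∈ G) (hH : IsPartialBuildingSet G H)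
    (s : Stage L) (hs : s.IsPartialBlowup H)
    (y : s.carrier) (hy : s.down y ≠ ⊤)
    (S : Set L) (hS : IsNested H S) (hSy : IsLUB {v | ∃ h ∈ S, s.elt h = some v} y) :
    ∃ (ψ : ∀ g : s.factorsPlus G y, s.LocalFactor G H y (g : L) →ₐ[ℚ] LocalDP H S)
      (e₁ : (⨂[ℚ] g : s.factorsPlus G y, s.LocalFactor G H y (g : L)) ≃ₐ[ℚ] LocalDP H S)
      (e₂ : (⨂[ℚ] g : ↥(s.factorsPlus G y ∩ nonAtoms H),
        s.LocalFactor G H y (g : L)) ≃ₐ[ℚ] LocalDP H S),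
      (∀ n, (tensorDegree (fun g : s.factorsPlus G y => s.localDegree G H y (g : L)) n).map
        e₁.toLinearMap = LocalDP.degree H S n) ∧
      (∀ n, (tensorDegree (fun g : ↥(s.factorsPlus G y ∩ nonAtoms H) =>
        s.localDegree G H y (g : L)) n).map e₂.toLinearMap = LocalDP.degree H S n) ∧
      (∀ a : ∀ g : s.factorsPlus G y, s.LocalFactor G H y (g : L),
        e₁ (PiTensorProduct.tprod ℚ a) = ∏ᶠ g, ψ g (a g)) ∧
      (∀ a : ∀ g : ↥(s.factorsPlus G y ∩ nonAtoms H), s.LocalFactor G H y (g : L),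
        e₂ (PiTensorProduct.tprod ℚ a) =
          ∏ᶠ g : ↥(s.factorsPlus G y ∩ nonAtoms H), ψ ⟨g, g.2.1⟩ (a g)) ∧
      ∀ (g : s.factorsPlus G y) (p : H) (q : s.localH G H y (g : L)),
        (p : L) ∈ closedStar H (s.supp H y) →
        IsHat (s.factorsPlus G y) p g →
        q.1.1 = (p : L) ⊔ base (s.factorsPlus G y) g →
        ¬ IsAtom q.1 →
        ((p : L) ≠ g →
          ψ g (LocalDP.mk _ _ (MvPolynomial.X q)) = LocalDP.mk H S (MvPolynomial.X p)) ∧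
        ((p : L) = g →
          ψ g (LocalDP.mk _ _ (MvPolynomial.X q)) = LocalDP.mk H S (linElt H (g : L))) := by
  obtain ⟨hN, D⟩ := hs.supp_eq hG hG_top hH hS hSy
  have hSN : ∀ T : Set L, IsNested H (S ∪ T) → IsNested H (s.supp H y ∪ T) := fun T hT => by
    rw [hN]
    exact isNested_support_union hG hH hT
  have hSsub : S ⊆ s.supp H y := by
    rw [hN]
    exact subset_support hS.1
  obtain ⟨e₁, hdeg₁, he₁⟩ := D.exists_tensor_equiv hSN hSsub (J := s.factorsPlus G y)
    Set.inter_subset_left subset_rfl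
  obtain ⟨e₂, hdeg₂, he₂⟩ := D.exists_tensor_equiv hSN hSsub
    (J := s.factorsPlus G y ∩ nonAtoms H) subset_rfl Set.inter_subset_left
  refine ⟨fun g => D.psi hSN g.2, e₁, e₂, hdeg₁, hdeg₂, he₁, he₂, ?_⟩
  intro g p q hp hat hq hqn
  -- A local building set with a non-atom forces g into H°, so ψ_g is given by the values `starVar`.
  have hgn : (g : L) ∈ nonAtoms H := by
    by_contra hgn
    exact hqn (D.isAtom_of_notMem_nonAtoms hgn q.2)
  have hval : D.psi hSN g.2 (LocalDP.mk _ _ (MvPolynomial.X q)) = starVar H S g p :=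
    (D.psi_var hSN g.2 q).trans (D.localVar_eq hSN hgn p q hp hat hq)
  refine ⟨fun hne => hval.trans (if_neg hne), fun he => hval.trans ?_⟩
  rw [LocalDP.mk_linElt]
  exact if_pos he
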